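/- Let $d\ge 1$ and consider the Cauchy problem $$u_t=\Delta u+|u|^{p-1}u\quad (x\in\mathbb R^d,\ t>0),\qquad u(x,0)=u_0(x).$$ For $q\ge 1$, $s>0$ let $$\|f\|_{M^s_q}=\Big(\sup_{R>0,\,x\in\mathbb R^d}R^{d(q/s-1)}\int_{\{|y-x|<R\}}|f(y)|^q\,dy\Big)^{1/q}\in[0,\infty],\qquad M^s=M^s_1 .$$ For $0<T\le\infty$, a weak solution on $[0,T)$ with locally integrable initial value $u_0$ is a function $u$ which is in $L^p((0,\tau)\times B)$ for every $\tau<T$ and every ball $B\subset\mathbb R^d$, and which satisfies $$\int_0^T\!\!\int_{\mathbb R^d}\big(u(\varphi_t+\Delta\varphi)+|u|^{p-1}u\,\varphi\big)\,dx\,dt+\int_{\mathbb R^d}u_0(x)\varphi(x,0)\,dx=0$$ for all $\varphi\in C_c^\infty(\mathbb R^d\times(-\infty,T))$. A mild solution satisfies $u(t)=e^{t\Delta}u_0+\int_0^t e^{(t-\tau)\Delta}(|u|^{p-1}u)(\tau)\,d\tau$ at every $0<t<T$ and every $x\in\mathbb R^d$, with absolutely convergent integrals ($e^{t\Delta}$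 is convolution with the Gauss--Weierstrass kernel). There is a constant $C_d>0$, depending only on $d$, such that for every $p>1+\frac2d$ the following hold. (i) For every $q$ with $1<q\le \frac{d(p-1)}2$ there is a constant $c=c(d,p,q)>0$ such that every measurable $u_0:\mathbb R^d\to\mathbb R$ with $\|u_0\|_{M^{d(p-1)/2}_q}<c$ admits a global-in-time solution: a function $u$ on $\mathbb R^d\times(0,\infty)$ which is both a weak and a mild solution on $[0,\infty)$, is bounded on $\mathbb R^d\times[\varepsilon,\tau]$ for all $0<\varepsilon<\tau<\infty$, and is nonnegative if $u_0\ge0$ almost everywhere. (ii) If $u_0$ is locally integrable, $u_0\ge 0$ almost everywhere, and $\|u_0\|_{M^{d(p-1)/2}}>C_d$, then every nonnegative solution blows up in finite time: there is $T_0\in(0,\infty)$ such that every nonnegative weak solution on $[0,T)$, $0<T\le\infty$, with initial value $u_0$ has $T\le T_0$. -/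

import Mathlib

open MeasureTheory Set
open scoped ENNReal ContDiff

noncomputable section

/-- The (homogeneous) Morrey norm of `f : ℝ^d → ℝ` in `M^s_q`, as an extended nonnegative number:
`(sup_{x, R > 0} R^{d (q/s - 1)} ∫_{|y - x| < R} |f y|^q dy)^{1/q}`. -/
def morreyNorm {d : ℕ} (s q : ℝ) (f : EuclideanSpace ℝ (Fin d) → ℝ) : ℝ≥0∞ :=
  (⨆ (x : EuclideanSpace ℝ (Fin d)) (R : ℝ) (_ : 0 < R),
    ENNReal.ofReal (R ^ ((d : ℝ) * (q / s - 1))) * ∫⁻ y in Metric.ball x R, ‖f y‖ₑ ^ q) ^ (1 / q)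

/-- The Gauss--Weierstrass kernel `(4 π t)^{-d/2} exp(-|x|^2 / (4 t))`, for `t > 0`. -/
def heatKernel {d : ℕ} (t : ℝ) (x : EuclideanSpace ℝ (Fin d)) : ℝ :=
  (4 * Real.pi * t) ^ (-(d : ℝ) / 2) * Real.exp (-‖x‖ ^ 2 / (4 * t))

/-- The nonlinearity `|v|^{p-1} v`. -/
def powerNonlinearity (p v : ℝ) : ℝ := |v| ^ (p - 1) * v

/-- `u` is a weak (distributional) solution of `u_t = Δ u + |u|^{p-1} u` on `ℝ^d × [0, T)`,
`0 ≤ T ≤ ∞`, with the initial value `u₀`. The value `u t x` matters for `0 < t < T` only. -/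
structure IsWeakSolution {d : ℕ} (p : ℝ) (u₀ : EuclideanSpace ℝ (Fin d) → ℝ) (T : ℝ≥0∞)
    (u : ℝ → EuclideanSpace ℝ (Fin d) → ℝ) : Prop where
  /-- The initial value is locally integrable. -/
  init_locallyIntegrable : LocallyIntegrable u₀ volume
  /-- `u` is in `L^p` of every bounded cylinder `(0, τ) × B_R`, `τ < T`. -/
  memLp : ∀ τ R : ℝ, ENNReal.ofReal τ < T →
    MemLp (Function.uncurry u) (ENNReal.ofReal p)
      (volume.restrict (Ioo 0 τ ×ˢ Metric.ball (0 : EuclideanSpace ℝ (Fin d)) R))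
  /-- The equation, tested with smooth functions of compact support in `(-∞, T) × ℝ^d`. -/
  weak_eq : ∀ φ : ℝ × EuclideanSpace ℝ (Fin d) → ℝ, ContDiff ℝ ∞ φ → HasCompactSupport φ →
    (∀ z ∈ tsupport φ, ENNReal.ofReal z.1 < T) →
    (∫ z in Ioi (0 : ℝ) ×ˢ (univ : Set (EuclideanSpace ℝ (Fin d))),
        (u z.1 z.2 * (deriv (fun s => φ (s, z.2)) z.1
            + Laplacian.laplacian (fun y => φ (z.1, y)) z.2)
          + powerNonlinearity p (u z.1 z.2) * φ z))
      + ∫ x, u₀ x * φ (0, x) = 0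

/-- `u` is a mild solution of the same problem on `ℝ^d × [0, T)`: the Duhamel formula holds at
every `0 < t < T` and `x`, with absolutely convergent integrals. -/
def IsMildSolution {d : ℕ} (p : ℝ) (u₀ : EuclideanSpace ℝ (Fin d) → ℝ) (T : ℝ≥0∞)
    (u : ℝ → EuclideanSpace ℝ (Fin d) → ℝ) : Prop :=
  ∀ (t : ℝ) (x : EuclideanSpace ℝ (Fin d)), 0 < t → ENNReal.ofReal t < T →
    Integrable (fun y => heatKernel t (x - y) * u₀ y) ∧
    IntegrableOn (fun z : ℝ × EuclideanSpace ℝ (Fin d) =>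
      heatKernel (t - z.1) (x - z.2) * powerNonlinearity p (u z.1 z.2)) (Ioo 0 t ×ˢ univ) ∧
    u t x = (∫ y, heatKernel t (x - y) * u₀ y)
      + ∫ z in Ioo (0 : ℝ) t ×ˢ (univ : Set (EuclideanSpace ℝ (Fin d))),
          heatKernel (t - z.1) (x - z.2) * powerNonlinearity p (u z.1 z.2)

end

/-! The exponent $s=d(p-1)/2$ is the scaling-invariant one, so on every ball the Morrey quantity can
be compared with a pure number.

Blow-up is a test-function argument. Let $\varphi\le 1$ be a high power of a smooth cutoff, scaled
parabolically to $B_R(x_0)$ and to times below $2R^2$. Then $|\varphi_t+\Delta\varphi|\le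
KR^{-2}\varphi^{1/p}$, and Young's inequality (`mul_sub_rpow_mul_le`) bounds
$-(u(\varphi_t+\Delta\varphi)+u^p\varphi)$ by $(KR^{-2})^{p/(p-1)}$ for $u\ge0$. The weak equation
thus bounds $\int_{B_R}u_0$ for every solution that lives beyond $2R^2$
(`integral_ball_le_of_isWeakSolution`). The powers of $R$ cancel against the Morrey weight, and
$p>1+2/d$ gives $p/(p-1)\le 1+d/2$, so the bound depends on $d$ only. A ball that violates it
supplies $T_0=2R^2$.

Global existence rests on an explicit supersolution. Put $r=\min(p,q)$ and
$W=(e^{t\Delta}|u_0|^r)^{1/r}$. A small Morrey norm gives $W\le\kappa t^{-1/(p-1)}$ with small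
$\kappa$. Writing $W^p=W^rW^{p-r}$ and applying the semigroup law to $W^r=e^{t\Delta}|u_0|^r$, one
finds that the Duhamel integral of $W^p$ is at most a constant times $\kappa^{p-1}W$
(`lintegral_heatKernel_mul_heatMean_rpow_le`). Jensen gives $e^{t\Delta}|u_0|\le W$, so $2W$
dominates its own image under the Duhamel map with $|u_0|$ as data (`isMajorant_heatMean`). Because
the nonlinearity is increasing, iterating the Duhamel map downwards from $2W$ converges to a mild
solution (`IsMajorant.exists_fixedPoint`).

A mild solution bounded by the majorant is weak: by Fubini, the Duhamel formula tested with
$\varphi_t+\Delta\varphi$ reduces to the fact that the heat kernel is a fundamental solution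
(`integral_heatKernel_mul_adjointHeat`). -/

/-- The adjoint heat operator `φ_t + Δφ`, in terms of directional derivatives on space-time. -/
noncomputable def adjointHeat {d : ℕ} (φ : ℝ × EuclideanSpace ℝ (Fin d) → ℝ)
    (z : ℝ × EuclideanSpace ℝ (Fin d)) : ℝ :=
  fderiv ℝ φ z (1, 0) + ∑ i : Fin d,
    fderiv ℝ (fun w => fderiv ℝ φ w (0, EuclideanSpace.single i 1)) z (0, EuclideanSpace.single i 1)

/-! ### Derivatives of slices of space-time functions -/

section Calculus

variable {F : Type*} [NormedAddCommGroup F] [NormedSpace ℝ F]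

lemma ContDiff.fderiv_apply_const {φ : F → ℝ} (hφ : ContDiff ℝ ∞ φ) (v : F) :
    ContDiff ℝ ∞ (fun w => fderiv ℝ φ w v) :=
  (hφ.fderiv_right (m := ∞) (by simp)).clm_apply contDiff_const

lemma HasCompactSupport.fderiv_apply_const {φ : F → ℝ} (hφ : HasCompactSupport φ) (v : F) :
    HasCompactSupport (fun w => fderiv ℝ φ w v) :=
  hφ.fderiv_apply (𝕜 := ℝ) v

lemma fderiv_slice_right {φ : ℝ × F → ℝ} (hφ : Differentiable ℝ φ) (t : ℝ) (x v : F) :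
    fderiv ℝ (fun y => φ (t, y)) x v = fderiv ℝ φ (t, x) (0, v) := by
  have h := (hφ (t, x)).hasFDerivAt.comp x (hasFDerivAt_prodMk_right (𝕜 := ℝ) t x)
  have h' : HasFDerivAt (fun y => φ (t, y)) _ x := h
  rw [h'.fderiv]
  simp

lemma hasDerivAt_slice_left {φ : ℝ × F → ℝ} (hφ : Differentiable ℝ φ) (t : ℝ) (x : F) :
    HasDerivAt (fun s => φ (s, x)) (fderiv ℝ φ (t, x) (1, 0)) t := by
  have h := (hφ (t, x)).hasFDerivAt.comp_hasDerivAt t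
    ((hasDerivAt_id t).prodMk (hasDerivAt_const t x))
  exact h

end Calculus

/-! ### The adjoint heat operator on test functions -/

section AdjointHeat

variable {d : ℕ} {φ : ℝ × EuclideanSpace ℝ (Fin d) → ℝ}

lemma laplacian_slice (hφ : ContDiff ℝ ∞ φ) (t : ℝ) (x : EuclideanSpace ℝ (Fin d)) :
    Laplacian.laplacian (fun y => φ (t, y)) x = ∑ i : Fin d,
      fderiv ℝ (fun w => fderiv ℝ φ w (0, EuclideanSpace.single i 1)) (t, x)
        (0, EuclideanSpace.single i 1) := by
  rw [InnerProductSpace.laplacian_eq_iteratedFDeriv_orthonormalBasis _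
    (EuclideanSpace.basisFun (Fin d) ℝ)]
  refine Finset.sum_congr rfl fun i _ => ?_
  have hs : ContDiff ℝ ∞ (fun y => φ (t, y)) := hφ.comp (contDiff_const.prodMk contDiff_id)
  rw [iteratedFDeriv_two_apply]
  simp only [Matrix.cons_val_zero, Matrix.cons_val_one, EuclideanSpace.basisFun_apply]
  set e : EuclideanSpace ℝ (Fin d) := EuclideanSpace.single i 1
  have h1 : fderiv ℝ (fun y => fderiv ℝ (fun y => φ (t, y)) y e) x e
      = fderiv ℝ (fderiv ℝ fun y => φ (t, y)) x e e := by
    rw [fderiv_clm_apply _ (differentiableAt_const _)]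
    · simp
    · exact ((hs.fderiv_right (m := ∞) (by simp)).differentiable (by simp)) x
  rw [← h1]
  have h2 : (fun y => fderiv ℝ (fun y => φ (t, y)) y e) = fun y => fderiv ℝ φ (t, y) (0, e) :=
    funext fun y => fderiv_slice_right (hφ.differentiable (by simp)) t y e
  rw [h2]
  exact fderiv_slice_right ((hφ.fderiv_apply_const (0, e)).differentiable (by simp)) t x e

/-- Trades the slicewise derivatives of the weak formulation for space-time `fderiv`s, for which
continuity, support and scaling are immediate. -/
lemma deriv_add_laplacian_eq_adjointHeat (hφ : ContDiff ℝ ∞ φ)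
    (z : ℝ × EuclideanSpace ℝ (Fin d)) :
    deriv (fun s => φ (s, z.2)) z.1 + Laplacian.laplacian (fun y => φ (z.1, y)) z.2
      = adjointHeat φ z := by
  rw [laplacian_slice hφ, (hasDerivAt_slice_left (hφ.differentiable (by simp)) z.1 z.2).deriv]
  rfl

lemma continuous_adjointHeat (hφ : ContDiff ℝ ∞ φ) : Continuous (adjointHeat φ) := by
  refine (hφ.fderiv_apply_const _).continuous.add (continuous_finsetSum _ fun i _ => ?_)
  exact ((hφ.fderiv_apply_const _).fderiv_apply_const _).continuous

lemma tsupport_adjointHeat_subset : tsupport (adjointHeat φ) ⊆ tsupport φ := by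
  refine closure_minimal (fun z hz => ?_) (isClosed_tsupport _)
  by_contra hn
  apply hz
  have h1 : φ =ᶠ[nhds z] 0 := notMem_tsupport_iff_eventuallyEq.1 hn
  have h2 : ∀ v, (fun w => fderiv ℝ φ w v) =ᶠ[nhds z] 0 := fun v => by
    filter_upwards [h1.eventuallyEq_nhds] with w hw
    rw [hw.fderiv_eq]; simp
  unfold adjointHeat
  rw [(h2 (1, 0)).eq_of_nhds, Finset.sum_eq_zero]
  · simp
  · intro i _
    rw [(h2 (0, EuclideanSpace.single i 1)).fderiv_eq]; simp

lemma hasCompactSupport_adjointHeat (hc : HasCompactSupport φ) :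
    HasCompactSupport (adjointHeat φ) :=
  hc.mono' (subset_closure.trans tsupport_adjointHeat_subset)

end AdjointHeat

/-! ### Parabolically scaled cutoffs -/

section TestFunctions

variable {d : ℕ}

lemma adjointHeat_pow {Φ : ℝ × EuclideanSpace ℝ (Fin d) → ℝ} (hΦ : ContDiff ℝ ∞ Φ) (m : ℕ)
    (z : ℝ × EuclideanSpace ℝ (Fin d)) :
    adjointHeat (fun w => Φ w ^ (m + 2)) z = Φ z ^ m * ((m + 2) * Φ z * fderiv ℝ Φ z (1, 0)
      + ∑ i : Fin d, (m + 2) * ((m + 1) * fderiv ℝ Φ z (0, EuclideanSpace.single i 1) ^ 2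
        + Φ z * fderiv ℝ (fun w => fderiv ℝ Φ w (0, EuclideanSpace.single i 1)) z
          (0, EuclideanSpace.single i 1))) := by
  have hd : ∀ w, HasFDerivAt Φ (fderiv ℝ Φ w) w :=
    fun w => (hΦ.differentiable (by simp) w).hasFDerivAt
  have h1 : ∀ w v, fderiv ℝ (fun w => Φ w ^ (m + 2)) w v
      = (m + 2) * Φ w ^ (m + 1) * fderiv ℝ Φ w v := by
    intro w v
    have := ((hd w).pow (m + 2)).fderiv
    rw [this]
    simp
  unfold adjointHeat
  rw [mul_add, Finset.mul_sum]
  congr 1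
  · rw [h1]; ring
  · refine Finset.sum_congr rfl fun i _ => ?_
    set e : ℝ × EuclideanSpace ℝ (Fin d) := (0, EuclideanSpace.single i 1)
    have h2 : (fun w => fderiv ℝ (fun w => Φ w ^ (m + 2)) w e)
        = fun w => ((m : ℝ) + 2) * Φ w ^ (m + 1) * fderiv ℝ Φ w e := funext fun w => h1 w e
    have h3 : HasFDerivAt (fun w => fderiv ℝ Φ w e) (fderiv ℝ (fun w => fderiv ℝ Φ w e) z) z :=
      ((hΦ.fderiv_apply_const e).differentiable (by simp) z).hasFDerivAt
    have h4 := ((((hd z).pow (m + 1)).const_mul ((m : ℝ) + 2)).mul h3).fderiv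
    rw [h2]
    refine (DFunLike.congr_fun h4 e).trans ?_
    simp
    ring

/-- Two derivatives cost at most two of the $m+2$ factors of $\Phi$; the cofactor of $\Phi^m$ is
continuous, hence bounded on the compact support. The normalisation $K\ge1$ later makes $K^a$
monotone in $a$. -/
lemma exists_abs_adjointHeat_pow_le {Φ : ℝ × EuclideanSpace ℝ (Fin d) → ℝ} (hΦ : ContDiff ℝ ∞ Φ)
    (hc : HasCompactSupport Φ) (h0 : ∀ z, 0 ≤ Φ z) (m : ℕ) :
    ∃ K : ℝ, 1 ≤ K ∧ ∀ z, |adjointHeat (fun w => Φ w ^ (m + 2)) z| ≤ K * Φ z ^ m := by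
  have hcont : Continuous fun z => ((m : ℝ) + 2) * Φ z * fderiv ℝ Φ z (1, 0)
      + ∑ i : Fin d, ((m : ℝ) + 2) * ((m + 1) * fderiv ℝ Φ z (0, EuclideanSpace.single i 1) ^ 2
        + Φ z * fderiv ℝ (fun w => fderiv ℝ Φ w (0, EuclideanSpace.single i 1)) z
          (0, EuclideanSpace.single i 1)) := by
    have c1 := fun v => (hΦ.fderiv_apply_const v).continuous
    have c2 := fun v => ((hΦ.fderiv_apply_const v).fderiv_apply_const v).continuous
    refine ((continuous_const.mul hΦ.continuous).mul (c1 _)).add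
      (continuous_finsetSum _ fun i _ => continuous_const.mul ?_)
    exact (continuous_const.mul ((c1 _).pow 2)).add (hΦ.continuous.mul (c2 _))
  obtain ⟨K, hK⟩ := hc.isCompact.exists_bound_of_continuousOn hcont.continuousOn
  refine ⟨max K 1, le_max_right _ _, fun z => ?_⟩
  by_cases hz : z ∈ tsupport Φ
  · rw [adjointHeat_pow hΦ, abs_mul, abs_of_nonneg (pow_nonneg (h0 z) m), mul_comm]
    exact mul_le_mul_of_nonneg_right ((hK z hz).trans (le_max_left _ _)) (pow_nonneg (h0 z) m)
  · have : z ∉ tsupport (adjointHeat fun w => Φ w ^ (m + 2)) := fun h => hz <| by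
      refine closure_mono (fun w hw => ?_) (tsupport_adjointHeat_subset h)
      exact fun h => hw (by simp [h])
    rw [image_eq_zero_of_notMem_tsupport this, abs_zero]
    exact mul_nonneg (zero_le_one.trans (le_max_right _ _)) (pow_nonneg (h0 z) m)

/-- The parabolic dilation about `(0, x₀)`. -/
noncomputable def parabolicDilation (a : ℝ) (x₀ : EuclideanSpace ℝ (Fin d))
    (z : ℝ × EuclideanSpace ℝ (Fin d)) : ℝ × EuclideanSpace ℝ (Fin d) :=
  (a ^ 2 * z.1, a • (z.2 - x₀))

lemma contDiff_parabolicDilation (a : ℝ) (x₀ : EuclideanSpace ℝ (Fin d)) :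
    ContDiff ℝ ∞ (parabolicDilation a x₀) := by
  unfold parabolicDilation; fun_prop

lemma fderiv_comp_parabolicDilation {ψ : ℝ × EuclideanSpace ℝ (Fin d) → ℝ}
    (hψ : Differentiable ℝ ψ) (a : ℝ) (x₀ : EuclideanSpace ℝ (Fin d))
    (z v : ℝ × EuclideanSpace ℝ (Fin d)) :
    fderiv ℝ (fun w => ψ (parabolicDilation a x₀ w)) z v
      = fderiv ℝ ψ (parabolicDilation a x₀ z) (a ^ 2 * v.1, a • v.2) := by
  have hp : HasFDerivAt (parabolicDilation a x₀)
      ((a ^ 2 • ContinuousLinearMap.fst ℝ ℝ (EuclideanSpace ℝ (Fin d))).prod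
        (a • ContinuousLinearMap.snd ℝ ℝ (EuclideanSpace ℝ (Fin d)))) z := by
    refine HasFDerivAt.prodMk (hasFDerivAt_fst.const_mul (a ^ 2)) ?_
    exact (hasFDerivAt_snd.sub_const x₀).const_smul a
  have h := ((hψ _).hasFDerivAt.comp z hp).fderiv
  refine (DFunLike.congr_fun h v).trans ?_
  simp

lemma adjointHeat_comp_parabolicDilation {ψ : ℝ × EuclideanSpace ℝ (Fin d) → ℝ}
    (hψ : ContDiff ℝ ∞ ψ) (a : ℝ) (x₀ : EuclideanSpace ℝ (Fin d))
    (z : ℝ × EuclideanSpace ℝ (Fin d)) :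
    adjointHeat (fun w => ψ (parabolicDilation a x₀ w)) z
      = a ^ 2 * adjointHeat ψ (parabolicDilation a x₀ z) := by
  unfold adjointHeat
  rw [mul_add, Finset.mul_sum]
  have hd := hψ.differentiable (by simp)
  congr 1
  · rw [fderiv_comp_parabolicDilation hd]
    have : ((a ^ 2 * 1, a • 0) : ℝ × EuclideanSpace ℝ (Fin d)) = a ^ 2 • (1, 0) := by
      ext <;> simp
    simp only [this, map_smul, smul_eq_mul]
  · refine Finset.sum_congr rfl fun i _ => ?_
    set e : EuclideanSpace ℝ (Fin d) := EuclideanSpace.single i 1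
    have he : ((a ^ 2 * 0, a • e) : ℝ × EuclideanSpace ℝ (Fin d)) = a • (0, e) := by
      ext <;> simp
    have h1 : (fun w => fderiv ℝ (fun w => ψ (parabolicDilation a x₀ w)) w (0, e))
        = fun w => (fun y => a * fderiv ℝ ψ y (0, e)) (parabolicDilation a x₀ w) := by
      funext w
      rw [fderiv_comp_parabolicDilation hd]
      simp only [he, map_smul, smul_eq_mul]
    have hs := (hψ.fderiv_apply_const (0, e)).differentiable (by simp)
    rw [h1, fderiv_comp_parabolicDilation (hs.const_mul a)]
    simp only [he, map_smul, smul_eq_mul]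
    rw [fderiv_const_mul (hs _)]
    simp
    ring

/-- One fixed cutoff, transported by parabolic dilations, serves all balls: the operator picks up
exactly $R^{-2}$, so $K$ does not depend on $x_0$ or $R$. -/
lemma exists_parabolic_testFunction (d m : ℕ) :
    ∃ K : ℝ, 1 ≤ K ∧ ∀ (x₀ : EuclideanSpace ℝ (Fin d)) (R : ℝ), 0 < R →
      ∃ φ : ℝ × EuclideanSpace ℝ (Fin d) → ℝ, ContDiff ℝ ∞ φ ∧ HasCompactSupport φ ∧
        (∀ z, 0 ≤ φ z) ∧ (∀ z, φ z ≤ 1) ∧ (∀ z ∈ tsupport φ, z.1 ≤ 2 * R ^ 2) ∧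
        (∀ z, z ∉ Iio (2 * R ^ 2) ×ˢ Metric.ball x₀ (2 * R) → φ z = 0) ∧
        (∀ x ∈ Metric.ball x₀ R, φ (0, x) = 1) ∧
        ∀ z, |adjointHeat φ z| ≤ K * R⁻¹ ^ 2 * φ z ^ ((m : ℝ) / (m + 2)) := by
  let η : ContDiffBump (0 : ℝ) := ⟨1, 2, one_pos, one_lt_two⟩
  let χ : ContDiffBump (0 : EuclideanSpace ℝ (Fin d)) := ⟨1, 2, one_pos, one_lt_two⟩
  let Φ : ℝ × EuclideanSpace ℝ (Fin d) → ℝ := fun z => η z.1 * χ z.2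
  have hΦ : ContDiff ℝ ∞ Φ := (η.contDiff.comp contDiff_fst).mul (χ.contDiff.comp contDiff_snd)
  have hΦ0 : ∀ z, 0 ≤ Φ z := fun z => mul_nonneg η.nonneg χ.nonneg
  have hΦ1 : ∀ z, Φ z ≤ 1 := fun z => mul_le_one₀ η.le_one χ.nonneg χ.le_one
  have hΦz : ∀ z, z ∉ Ioo (-2) 2 ×ˢ Metric.ball 0 2 → Φ z = 0 := by
    intro z hz
    by_cases h1 : z.1 ∈ Ioo (-2 : ℝ) 2
    · have : χ z.2 = 0 := χ.zero_of_le_dist (by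
        by_contra h
        exact hz ⟨h1, not_le.1 h⟩)
      simp [Φ, this]
    · have : η z.1 = 0 := η.zero_of_le_dist (by
        by_contra h
        have h' : |z.1| < 2 := by simpa using not_le.1 h
        exact h1 (abs_lt.1 h'))
      simp [Φ, this]
  have hΦc : HasCompactSupport Φ :=
    HasCompactSupport.intro (K := Icc (-2) 2 ×ˢ Metric.closedBall 0 2)
      (isCompact_Icc.prod (isCompact_closedBall _ _)) fun z hz => hΦz z fun h =>
        hz ⟨Ioo_subset_Icc_self h.1, Metric.ball_subset_closedBall h.2⟩
  obtain ⟨K, hK1, hK⟩ := exists_abs_adjointHeat_pow_le hΦ hΦc hΦ0 m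
  refine ⟨K, hK1, fun x₀ R hR => ?_⟩
  have hmem : ∀ z : ℝ × EuclideanSpace ℝ (Fin d),
      parabolicDilation R⁻¹ x₀ z ∈ Ioo (-2 : ℝ) 2 ×ˢ Metric.ball 0 2 →
        z ∈ Ioo (-(2 * R ^ 2)) (2 * R ^ 2) ×ˢ Metric.ball x₀ (2 * R) := by
    rintro z ⟨⟨h1, h1'⟩, h2⟩
    simp only [parabolicDilation] at h1 h1' h2
    rw [mem_ball_zero_iff, norm_smul, norm_inv, Real.norm_of_nonneg hR.le] at h2
    rw [inv_pow] at h1 h1'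
    have hR2 : 0 < R ^ 2 := by positivity
    have e1 : (R ^ 2)⁻¹ * z.1 * R ^ 2 = z.1 := by field_simp
    have e2 : R⁻¹ * ‖z.2 - x₀‖ * R = ‖z.2 - x₀‖ := by field_simp
    refine ⟨⟨?_, ?_⟩, ?_⟩
    · nlinarith
    · nlinarith
    · rw [mem_ball_iff_norm]; nlinarith
  have hφz : ∀ z, z ∉ Ioo (-(2 * R ^ 2)) (2 * R ^ 2) ×ˢ Metric.ball x₀ (2 * R) →
      Φ (parabolicDilation R⁻¹ x₀ z) ^ (m + 2) = 0 := fun z hz => by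
    rw [hΦz _ fun h => hz (hmem z h)]; simp
  refine ⟨fun z => Φ (parabolicDilation R⁻¹ x₀ z) ^ (m + 2),
    (hΦ.comp (contDiff_parabolicDilation _ _)).pow _, ?_, fun z => pow_nonneg (hΦ0 _) _,
    fun z => pow_le_one₀ (hΦ0 _) (hΦ1 _), ?_, fun z hz => hφz z fun h => hz ⟨h.1.2, h.2⟩, ?_, ?_⟩
  · refine HasCompactSupport.intro
      (K := Icc (-(2 * R ^ 2)) (2 * R ^ 2) ×ˢ Metric.closedBall x₀ (2 * R))
      (isCompact_Icc.prod (isCompact_closedBall _ _)) fun z hz => hφz z fun h =>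
        hz ⟨Ioo_subset_Icc_self h.1, Metric.ball_subset_closedBall h.2⟩
  · refine closure_minimal (fun z hz => ?_) (isClosed_le continuous_fst continuous_const)
    by_contra h
    exact hz (hφz z fun h' => h h'.1.2.le)
  · intro x hx
    have h1 : η (R⁻¹ ^ 2 * 0) = 1 := η.one_of_mem_closedBall (by simp [η])
    have h2 : χ (R⁻¹ • (x - x₀)) = 1 := χ.one_of_mem_closedBall (by
      rw [mem_ball_iff_norm] at hx
      rw [mem_closedBall_zero_iff, norm_smul, norm_inv, Real.norm_of_nonneg hR.le,
        inv_mul_le_iff₀ hR]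
      simpa [χ] using hx.le)
    simp only [Φ, parabolicDilation, h1, h2]
    simp
  · intro z
    have e : (fun z => Φ (parabolicDilation R⁻¹ x₀ z) ^ (m + 2))
        = fun z => (fun w => Φ w ^ (m + 2)) (parabolicDilation R⁻¹ x₀ z) := rfl
    rw [e, adjointHeat_comp_parabolicDilation (hΦ.pow _), abs_mul,
      abs_of_nonneg (by positivity : (0 : ℝ) ≤ R⁻¹ ^ 2)]
    have e2 : (Φ (parabolicDilation R⁻¹ x₀ z) ^ (m + 2)) ^ ((m : ℝ) / (m + 2))
        = Φ (parabolicDilation R⁻¹ x₀ z) ^ m := by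
      rw [← Real.rpow_natCast, ← Real.rpow_mul (hΦ0 _), ← Real.rpow_natCast _ m]
      congr 1
      push_cast
      field_simp
    simp only [e2]
    calc R⁻¹ ^ 2 * |_| ≤ R⁻¹ ^ 2 * (K * Φ (parabolicDilation R⁻¹ x₀ z) ^ m) := by
          gcongr; exact hK _
      _ = _ := by ring

end TestFunctions

/-! ### Pointwise inequality for the test-function method -/

lemma powerNonlinearity_of_nonneg {p v : ℝ} (hp : 1 < p) (hv : 0 ≤ v) :
    powerNonlinearity p v = v ^ p := by
  unfold powerNonlinearity
  rw [abs_of_nonneg hv]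
  rcases hv.eq_or_lt with rfl | h
  · rw [mul_zero, Real.zero_rpow (by linarith)]
  · rw [← Real.rpow_add_one h.ne', sub_add_cancel]

/-- Young's inequality for the product of $v\varphi^{1/p}$ and $\kappa$: the term $v^p\varphi/p$ is
absorbed by $v^p\varphi$. -/
lemma mul_sub_rpow_mul_le {p κ v L φ : ℝ} (hp : 1 < p) (hκ : 0 ≤ κ) (hv : 0 ≤ v) (hφ : 0 ≤ φ)
    (hL : |L| ≤ κ * φ ^ (1 / p)) : -(v * L + v ^ p * φ) ≤ κ ^ (p / (p - 1)) := by
  have hpq : p.HolderConjugate (p / (p - 1)) := Real.HolderConjugate.conjExponent hp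
  have hφ' : 0 ≤ φ ^ (1 / p) := Real.rpow_nonneg hφ _
  have h1 := Real.young_inequality (v * φ ^ (1 / p)) κ hpq
  rw [abs_of_nonneg (mul_nonneg hv hφ'), abs_of_nonneg hκ, Real.mul_rpow hv hφ',
    ← Real.rpow_mul hφ, one_div_mul_cancel (by linarith), Real.rpow_one] at h1
  have h2 : v ^ p * φ / p ≤ v ^ p * φ :=
    div_le_self (mul_nonneg (Real.rpow_nonneg hv _) hφ) hp.le
  have h3 : κ ^ (p / (p - 1)) / (p / (p - 1)) ≤ κ ^ (p / (p - 1)) :=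
    div_le_self (Real.rpow_nonneg hκ _) hpq.symm.lt.le
  have h4 : -(v * L) ≤ v * φ ^ (1 / p) * κ := by
    calc -(v * L) = v * (-L) := by ring
      _ ≤ v * (κ * φ ^ (1 / p)) := by gcongr; exact (neg_le_abs L).trans hL
      _ = _ := by ring
  linarith

/-! ### Finite-time blow-up for large Morrey norm -/

section Blowup

variable {d : ℕ}

lemma integral_ball_le_of_isWeakSolution {p K R : ℝ} (hp : 1 < p) (hK : 0 ≤ K) (hR : 0 < R)
    {x₀ : EuclideanSpace ℝ (Fin d)} {φ : ℝ × EuclideanSpace ℝ (Fin d) → ℝ}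
    (hφ : ContDiff ℝ ∞ φ) (hc : HasCompactSupport φ) (h0 : ∀ z, 0 ≤ φ z)
    (ht : ∀ z ∈ tsupport φ, z.1 ≤ 2 * R ^ 2)
    (hz : ∀ z, z ∉ Iio (2 * R ^ 2) ×ˢ Metric.ball x₀ (2 * R) → φ z = 0)
    (h1 : ∀ x ∈ Metric.ball x₀ R, φ (0, x) = 1)
    (hL : ∀ z, |adjointHeat φ z| ≤ K * R⁻¹ ^ 2 * φ z ^ (1 / p))
    {u₀ : EuclideanSpace ℝ (Fin d) → ℝ} (hu₀ : ∀ᵐ x, 0 ≤ u₀ x) {T : ℝ≥0∞}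
    {u : ℝ → EuclideanSpace ℝ (Fin d) → ℝ} (hu : IsWeakSolution p u₀ T u)
    (hpos : ∀ᵐ z : ℝ × EuclideanSpace ℝ (Fin d),
      0 < z.1 → ENNReal.ofReal z.1 < T → 0 ≤ u z.1 z.2)
    (hT : ENNReal.ofReal (2 * R ^ 2) < T) :
    ∫ x in Metric.ball x₀ R, u₀ x ≤ (K * R⁻¹ ^ 2) ^ (p / (p - 1))
      * (2 * R ^ 2 * volume.real (Metric.ball x₀ (2 * R))) := by
  set κ := K * R⁻¹ ^ 2 with hκ
  have hκ0 : 0 ≤ κ := by positivity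
  set S : Set (ℝ × EuclideanSpace ℝ (Fin d)) := Ioo 0 (2 * R ^ 2) ×ˢ Metric.ball x₀ (2 * R)
  have hS : MeasurableSet S := measurableSet_Ioo.prod measurableSet_ball
  have hSv : volume.real S = 2 * R ^ 2 * volume.real (Metric.ball x₀ (2 * R)) := by
    have hpos : (0 : ℝ) ≤ R ^ 2 := by positivity
    simp [S, Measure.real, Measure.volume_eq_prod, Measure.prod_prod, ENNReal.toReal_mul, hpos]
  have hSfin : volume S ≠ ⊤ := by
    simp only [S, Measure.volume_eq_prod, Measure.prod_prod, Real.volume_Ioo]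
    exact ENNReal.mul_ne_top ENNReal.ofReal_ne_top measure_ball_lt_top.ne
  have hT' : ∀ z ∈ tsupport φ, ENNReal.ofReal z.1 < T := fun z hz =>
    (ENNReal.ofReal_le_ofReal (ht z hz)).trans_lt hT
  have heq := hu.weak_eq φ hφ hc hT'
  have hbound : -∫ z in Ioi (0 : ℝ) ×ˢ (univ : Set (EuclideanSpace ℝ (Fin d))),
        (u z.1 z.2 * (deriv (fun s => φ (s, z.2)) z.1
            + Laplacian.laplacian (fun y => φ (z.1, y)) z.2)
          + powerNonlinearity p (u z.1 z.2) * φ z)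
      ≤ κ ^ (p / (p - 1)) * volume.real S := by
    rw [← integral_neg]
    have hrhs : ∫ z in Ioi (0 : ℝ) ×ˢ (univ : Set (EuclideanSpace ℝ (Fin d))),
        S.indicator (fun _ => κ ^ (p / (p - 1))) z = κ ^ (p / (p - 1)) * volume.real S := by
      rw [setIntegral_indicator hS, inter_eq_right.2 (prod_mono Ioo_subset_Ioi_self
        (subset_univ _)), setIntegral_const, smul_eq_mul, mul_comm]
    rw [← hrhs]
    -- If the integrand were not integrable, its Bochner integral would be $0$ and the bound would
    -- hold because its right side is nonnegative; so integrability need not be proved.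
    by_cases hint : Integrable (fun z : ℝ × EuclideanSpace ℝ (Fin d) =>
        -(u z.1 z.2 * (deriv (fun s => φ (s, z.2)) z.1
            + Laplacian.laplacian (fun y => φ (z.1, y)) z.2)
          + powerNonlinearity p (u z.1 z.2) * φ z))
        (volume.restrict (Ioi (0 : ℝ) ×ˢ (univ : Set (EuclideanSpace ℝ (Fin d)))))
    · refine integral_mono_ae hint ((integrable_indicator_iff hS).2
        (integrableOn_const hSfin)).integrableOn ?_
      filter_upwards [ae_restrict_of_ae hpos,
        ae_restrict_mem (measurableSet_Ioi.prod MeasurableSet.univ)] with z hzp hz0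
      rw [deriv_add_laplacian_eq_adjointHeat hφ]
      by_cases hzS : z ∈ S
      · rw [indicator_of_mem hzS]
        have hv : 0 ≤ u z.1 z.2 := hzp hz0.1
          ((ENNReal.ofReal_le_ofReal hzS.1.2.le).trans_lt hT)
        rw [powerNonlinearity_of_nonneg hp hv]
        exact mul_sub_rpow_mul_le hp hκ0 hv (h0 z) (hL z)
      · rw [indicator_of_notMem hzS]
        have hφ0 : φ z = 0 := hz z fun h => hzS ⟨⟨hz0.1, h.1⟩, h.2⟩
        have hL0 : adjointHeat φ z = 0 := by
          have := hL z
          rw [hφ0, Real.zero_rpow (by positivity), mul_zero] at this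
          exact abs_nonpos_iff.1 this
        rw [hφ0, hL0]; simp
    · rw [integral_undef hint]
      exact integral_nonneg fun z => indicator_nonneg (fun _ _ => Real.rpow_nonneg hκ0 _) z
  have hloc : ∫ x in Metric.ball x₀ R, u₀ x ≤ ∫ x, u₀ x * φ (0, x) := by
    have hint : Integrable fun x => u₀ x * φ (0, x) := by
      have hcs : HasCompactSupport fun x => φ (0, x) :=
        HasCompactSupport.intro (hc.isCompact.image continuous_snd)
          fun x hx => image_eq_zero_of_notMem_tsupport fun h => hx ⟨_, h, rfl⟩
      simpa [mul_comm] using hu.init_locallyIntegrable.integrable_smul_left_of_hasCompactSupport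
        (hφ.continuous.comp (by fun_prop)) hcs
    rw [← setIntegral_congr_fun (g := u₀) (f := fun x => u₀ x * φ (0, x)) measurableSet_ball
      (fun x hx => by simp [h1 x hx])]
    exact setIntegral_le_integral hint (by
      filter_upwards [hu₀] with x hx using mul_nonneg hx (h0 _))
  rw [← hSv]
  linarith

/-- The exponents of $R$ sum to $2/(p-1)-2p/(p-1)+2=0$, which is the criticality of the Morrey
space. -/
lemma rpow_bound_ball {K R p b : ℝ} (hd : 1 ≤ d) (hp : 1 + 2 / (d : ℝ) < p) (hK : 1 ≤ K)
    (hR : 0 < R) (hb : 0 ≤ b) :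
    R ^ ((d : ℝ) * (1 / ((d : ℝ) * (p - 1) / 2) - 1)) * ((K * R⁻¹ ^ 2) ^ (p / (p - 1))
      * (2 * R ^ 2 * ((2 * R) ^ d * b))) ≤ K ^ (1 + (d : ℝ) / 2) * (2 * (2 ^ d * b)) := by
  have hd0 : (0 : ℝ) < d := by exact_mod_cast hd
  have hp1 : 0 < p - 1 := by have : 0 < 2 / (d : ℝ) := by positivity
                             linarith
  have e1 : (K * R⁻¹ ^ 2) ^ (p / (p - 1)) = K ^ (p / (p - 1)) * R ^ (-(2 * (p / (p - 1)))) := by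
    rw [Real.mul_rpow (by linarith) (by positivity)]
    congr 1
    rw [← Real.rpow_natCast, ← Real.rpow_mul (by positivity), Real.inv_rpow hR.le,
      ← Real.rpow_neg hR.le]
    norm_num
  have e2 : R ^ ((d : ℝ) * (1 / ((d : ℝ) * (p - 1) / 2) - 1)) * (R ^ (-(2 * (p / (p - 1))))
      * (R ^ (2 : ℝ) * R ^ (d : ℝ))) = 1 := by
    rw [← Real.rpow_add hR, ← Real.rpow_add hR, ← Real.rpow_add hR]
    convert Real.rpow_zero R using 2
    field_simp
    ring
  -- This removes $p$ from the constant: $d(p-1)>2$ means $1/(p-1)<d/2$.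
  have e3 : K ^ (p / (p - 1)) ≤ K ^ (1 + (d : ℝ) / 2) := by
    refine Real.rpow_le_rpow_of_exponent_le hK ?_
    have h : 2 < d * (p - 1) := by
      have : 2 / (d : ℝ) < p - 1 := by linarith
      rw [div_lt_iff₀ hd0] at this
      linarith
    rw [div_le_iff₀ hp1]
    nlinarith
  rw [Real.rpow_two, Real.rpow_natCast] at e2
  calc _ = K ^ (p / (p - 1)) * (2 * (2 ^ d * b)) *
        (R ^ ((d : ℝ) * (1 / ((d : ℝ) * (p - 1) / 2) - 1)) * (R ^ (-(2 * (p / (p - 1))))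
      * (R ^ 2 * R ^ d))) := by rw [e1, mul_pow]; ring
    _ = K ^ (p / (p - 1)) * (2 * (2 ^ d * b)) := by rw [e2, mul_one]
    _ ≤ _ := by gcongr

theorem exists_blowup_constant (hd : 1 ≤ d) :
    ∃ C : ℝ, 0 < C ∧ ∀ p : ℝ, 1 + 2 / (d : ℝ) < p →
      ∀ u₀ : EuclideanSpace ℝ (Fin d) → ℝ, (∀ᵐ x, 0 ≤ u₀ x) →
        ENNReal.ofReal C < morreyNorm ((d : ℝ) * (p - 1) / 2) 1 u₀ →
        ∃ T₀ : ℝ, 0 < T₀ ∧ ∀ (T : ℝ≥0∞) (u : ℝ → EuclideanSpace ℝ (Fin d) → ℝ),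
          IsWeakSolution p u₀ T u →
          (∀ᵐ z : ℝ × EuclideanSpace ℝ (Fin d),
            0 < z.1 → ENNReal.ofReal z.1 < T → 0 ≤ u z.1 z.2) →
          T ≤ ENNReal.ofReal T₀ := by
  -- With $m=d$ the exponent $m/(m+2)$ equals $1/(1+2/d)$, which exceeds $1/p$ for every admissible
  -- $p$. As $0\le\varphi\le1$, the same test function then works for all $p$.
  obtain ⟨K, hK1, hK⟩ := exists_parabolic_testFunction d d
  set b := volume.real (Metric.ball (0 : EuclideanSpace ℝ (Fin d)) 1)
  have hb : 0 < b := ENNReal.toReal_pos (Metric.measure_ball_pos _ _ one_pos).ne'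
    measure_ball_lt_top.ne
  refine ⟨K ^ (1 + (d : ℝ) / 2) * (2 * (2 ^ d * b)), by positivity, fun p hp u₀ hu₀ hC => ?_⟩
  have hd0 : (0 : ℝ) < d := by exact_mod_cast hd
  have hp1 : 1 < p := by have : 0 < 2 / (d : ℝ) := by positivity
                         linarith
  simp only [morreyNorm, div_one, ENNReal.rpow_one, lt_iSup_iff] at hC
  obtain ⟨x₀, R, hR, hC⟩ := hC
  refine ⟨2 * R ^ 2, by positivity, fun T u hu hpos => ?_⟩
  by_contra! hT
  obtain ⟨φ, hφ, hc, h0, h1, ht, hz, hone, hL⟩ := hK x₀ R hR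
  have hL' : ∀ z, |adjointHeat φ z| ≤ K * R⁻¹ ^ 2 * φ z ^ (1 / p) := fun z => by
    refine (hL z).trans (mul_le_mul_of_nonneg_left ?_ (by positivity))
    refine Real.rpow_le_rpow_of_exponent_ge_of_imp (h0 z) (h1 z) ?_ ?_
    · rw [div_le_div_iff₀ (by linarith) (by positivity)]
      have : (1 + 2 / (d : ℝ)) * d = d + 2 := by field_simp
      nlinarith
    · intro _ h
      exact absurd h (by positivity)
  have hint := integral_ball_le_of_isWeakSolution hp1 (by linarith) hR hφ hc h0 ht hz hone hL' hu₀
    hu hpos hT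
  have hvol : volume.real (Metric.ball x₀ (2 * R)) = (2 * R) ^ d * b := by
    rw [Measure.real, Measure.addHaar_ball_of_pos volume x₀ (by positivity : 0 < 2 * R),
      ENNReal.toReal_mul, ENNReal.toReal_ofReal (by positivity), finrank_euclideanSpace_fin]
    rfl
  have hli : ∫⁻ y in Metric.ball x₀ R, ‖u₀ y‖ₑ = ENNReal.ofReal (∫ y in Metric.ball x₀ R, u₀ y) := by
    rw [ofReal_integral_eq_lintegral_ofReal
      ((hu.init_locallyIntegrable.integrableOn_isCompact
        (isCompact_closedBall x₀ R)).mono_set Metric.ball_subset_closedBall)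
      (ae_restrict_of_ae hu₀)]
    refine lintegral_congr_ae (ae_restrict_of_ae ?_)
    filter_upwards [hu₀] with y hy using Real.enorm_of_nonneg hy
  rw [hli, ← ENNReal.ofReal_mul (by positivity)] at hC
  refine hC.not_ge (ENNReal.ofReal_le_ofReal ?_)
  rw [hvol] at hint
  exact (mul_le_mul_of_nonneg_left hint (by positivity)).trans
    (rpow_bound_ball hd hp hK1 hR hb.le)

end Blowup

/-! ### Gauss–Weierstrass kernel, semigroup law and Morrey bounds -/

section HeatKernel

variable {d : ℕ}

lemma heatKernel_pos {t : ℝ} (ht : 0 < t) (x : EuclideanSpace ℝ (Fin d)) : 0 < heatKernel t x :=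
  mul_pos (Real.rpow_pos_of_pos (by positivity) _) (Real.exp_pos _)

lemma measurable_heatKernel :
    Measurable fun z : ℝ × EuclideanSpace ℝ (Fin d) => heatKernel z.1 z.2 := by
  unfold heatKernel
  fun_prop

@[fun_prop]
lemma Measurable.heatKernel {α : Type*} [MeasurableSpace α] {f : α → ℝ}
    {g : α → EuclideanSpace ℝ (Fin d)} (hf : Measurable f) (hg : Measurable g) :
    Measurable fun a => heatKernel (f a) (g a) :=
  measurable_heatKernel.comp (hf.prodMk hg)

lemma integral_heatKernel {t : ℝ} (ht : 0 < t) :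
    ∫ x : EuclideanSpace ℝ (Fin d), heatKernel t x = 1 := by
  unfold heatKernel
  rw [integral_const_mul]
  have h := GaussianFourier.integral_rexp_neg_mul_sq_norm (V := EuclideanSpace ℝ (Fin d))
    (b := 1 / (4 * t)) (by positivity)
  have e : ∀ x : EuclideanSpace ℝ (Fin d), -(1 / (4 * t)) * ‖x‖ ^ 2 = -‖x‖ ^ 2 / (4 * t) :=
    fun x => by ring
  simp only [e] at h
  rw [h, finrank_euclideanSpace_fin, neg_div,
    show Real.pi / (1 / (4 * t)) = 4 * Real.pi * t by field_simp, Real.rpow_neg (by positivity)]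
  exact inv_mul_cancel₀ (by positivity)

lemma integrable_heatKernel {t : ℝ} (ht : 0 < t) :
    Integrable fun x : EuclideanSpace ℝ (Fin d) => heatKernel t x :=
  integrable_of_integral_eq_one (integral_heatKernel ht)

lemma lintegral_heatKernel {t : ℝ} (ht : 0 < t) :
    ∫⁻ x : EuclideanSpace ℝ (Fin d), ENNReal.ofReal (heatKernel t x) = 1 := by
  rw [← ofReal_integral_eq_lintegral_ofReal (integrable_heatKernel ht)
    (Filter.Eventually.of_forall fun x => (heatKernel_pos ht x).le), integral_heatKernel ht,
    ENNReal.ofReal_one]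

/-- Completing the square in $y$. Integrating the last Gaussian away yields the semigroup law. -/
lemma heatKernel_mul_heatKernel {a b : ℝ} (ha : 0 < a) (hb : 0 < b)
    (x y z : EuclideanSpace ℝ (Fin d)) :
    heatKernel a (x - y) * heatKernel b (y - z)
      = heatKernel (a + b) (x - z)
        * heatKernel (a * b / (a + b)) (y - (a + b)⁻¹ • (b • x + a • z)) := by
  unfold heatKernel
  have hab : 0 < a + b := add_pos ha hb
  rw [mul_mul_mul_comm, mul_mul_mul_comm ((4 * Real.pi * (a + b)) ^ _), ← Real.mul_rpow (by positivity) (by positivity),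
    ← Real.mul_rpow (by positivity) (by positivity), ← Real.exp_add, ← Real.exp_add]
  congr 1
  · congr 1; field_simp
  · congr 1
    -- In the differences $p=x-y$, $q=y-z$ the exponents become an identity between quadratic forms.
    obtain ⟨p, rfl⟩ : ∃ p, x = p + y := ⟨x - y, by simp⟩
    obtain ⟨q, rfl⟩ : ∃ q, z = y - q := ⟨y - z, by simp⟩
    have e : y - (a + b)⁻¹ • (b • (p + y) + a • (y - q)) = (a + b)⁻¹ • (a • q - b • p) := by
      have : y = (a + b)⁻¹ • ((a + b) • y) := by rw [smul_smul, inv_mul_cancel₀ hab.ne', one_smul]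
      nth_rewrite 1 [this]
      rw [← smul_sub]
      congr 1
      module
    rw [e, add_sub_cancel_right, sub_sub_cancel, show p + y - (y - q) = p + q by abel, norm_smul,
      mul_pow, norm_sub_sq_real, norm_add_sq_real, norm_smul, norm_smul, inner_smul_left,
      inner_smul_right, real_inner_comm p q, norm_inv, Real.norm_of_nonneg hab.le,
      Real.norm_of_nonneg ha.le, Real.norm_of_nonneg hb.le]
    simp only [RCLike.conj_to_real]
    field_simp
    ring

lemma lintegral_heatKernel_mul_heatKernel {a b : ℝ} (ha : 0 < a) (hb : 0 < b)
    (x z : EuclideanSpace ℝ (Fin d)) :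
    ∫⁻ y, ENNReal.ofReal (heatKernel a (x - y)) * ENNReal.ofReal (heatKernel b (y - z))
      = ENNReal.ofReal (heatKernel (a + b) (x - z)) := by
  simp_rw [← ENNReal.ofReal_mul (heatKernel_pos ha _).le, heatKernel_mul_heatKernel ha hb,
    ENNReal.ofReal_mul (heatKernel_pos (add_pos ha hb) _).le]
  rw [lintegral_const_mul _ (by fun_prop),
    lintegral_sub_right_eq_self (fun y => ENNReal.ofReal (heatKernel (a * b / (a + b)) y)),
    lintegral_heatKernel (by positivity), mul_one]

/-- The heat semigroup `e^{tΔ}` acting on nonnegative functions. -/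
noncomputable def heatFlow (f : EuclideanSpace ℝ (Fin d) → ℝ≥0∞) (t : ℝ)
    (x : EuclideanSpace ℝ (Fin d)) : ℝ≥0∞ :=
  ∫⁻ y, ENNReal.ofReal (heatKernel t (x - y)) * f y

lemma measurable_heatFlow {f : EuclideanSpace ℝ (Fin d) → ℝ≥0∞} (hf : Measurable f) :
    Measurable fun z : ℝ × EuclideanSpace ℝ (Fin d) => heatFlow f z.1 z.2 := by
  unfold heatFlow
  refine Measurable.lintegral_prod_right' (f := fun w : (ℝ × EuclideanSpace ℝ (Fin d)) ×
    EuclideanSpace ℝ (Fin d) => ENNReal.ofReal (heatKernel w.1.1 (w.1.2 - w.2)) * f w.2) ?_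
  fun_prop

lemma heatFlow_heatFlow {f : EuclideanSpace ℝ (Fin d) → ℝ≥0∞} (hf : Measurable f) {a b : ℝ}
    (ha : 0 < a) (hb : 0 < b) (x : EuclideanSpace ℝ (Fin d)) :
    heatFlow (heatFlow f b) a x = heatFlow f (a + b) x := by
  unfold heatFlow
  simp_rw [← lintegral_const_mul' _ _ ENNReal.ofReal_ne_top]
  rw [lintegral_lintegral_swap (by fun_prop)]
  refine lintegral_congr fun z => ?_
  simp_rw [← mul_assoc]
  rw [lintegral_mul_const _ (by fun_prop), lintegral_heatKernel_mul_heatKernel ha hb]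

/-- Jensen's inequality for the probability measure with density the heat kernel centred at $x$. -/
lemma heatFlow_rpow_le {u : EuclideanSpace ℝ (Fin d) → ℝ} (hu : Measurable u) {t r q : ℝ}
    (ht : 0 < t) (hr : 0 < r) (hrq : r ≤ q) (x : EuclideanSpace ℝ (Fin d)) :
    heatFlow (fun y => ‖u y‖ₑ ^ r) t x ^ (1 / r) ≤ heatFlow (fun y => ‖u y‖ₑ ^ q) t x ^ (1 / q) := by
  have hm : Measurable fun y => ENNReal.ofReal (heatKernel t (x - y)) := by fun_prop
  set μ := (volume : Measure (EuclideanSpace ℝ (Fin d))).withDensity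
    fun y => ENNReal.ofReal (heatKernel t (x - y))
  have : IsProbabilityMeasure μ := ⟨by
    rw [withDensity_apply _ MeasurableSet.univ, Measure.restrict_univ,
      lintegral_sub_left_eq_self (fun y => ENNReal.ofReal (heatKernel t y)) x,
      lintegral_heatKernel ht]⟩
  have h := eLpNorm'_le_eLpNorm'_of_exponent_le hr hrq μ hu.aestronglyMeasurable
  simp only [eLpNorm'_eq_lintegral_enorm] at h
  rwa [lintegral_withDensity_eq_lintegral_mul _ hm (by fun_prop),
    lintegral_withDensity_eq_lintegral_mul _ hm (by fun_prop)] at h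

/-- Only the term $k=\lfloor\|z\|/\sqrt t\rfloor$ is needed: there the Gaussian factor is at most
$e^{-k^2/4}\le e^{1-k}$, since $(k-2)^2\ge0$. -/
lemma heatKernel_le_tsum {t : ℝ} (ht : 0 < t) (z : EuclideanSpace ℝ (Fin d)) :
    ENNReal.ofReal (heatKernel t z) ≤ ∑' k : ℕ, (Metric.ball 0 ((k + 1) * √t)).indicator
      (fun _ => ENNReal.ofReal (t ^ (-(d : ℝ) / 2) * Real.exp (1 - k))) z := by
  have hs : 0 < √t := Real.sqrt_pos.2 ht
  set k := ⌊‖z‖ / √t⌋₊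
  have hk : (k : ℝ) ≤ ‖z‖ / √t := Nat.floor_le (by positivity)
  have hk' : ‖z‖ / √t < k + 1 := Nat.lt_floor_add_one _
  refine le_trans ?_ (ENNReal.le_tsum k)
  rw [indicator_of_mem (by rw [mem_ball_zero_iff]; exact (div_lt_iff₀ hs).1 hk')]
  refine ENNReal.ofReal_le_ofReal (mul_le_mul ?_ ?_ (Real.exp_pos _).le (by positivity))
  · rw [Real.mul_rpow (by positivity) ht.le]
    refine mul_le_of_le_one_left (by positivity) (Real.rpow_le_one_of_one_le_of_nonpos ?_ ?_)
    · linarith [Real.pi_gt_three]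
    · rw [neg_div]; exact neg_nonpos.2 (by positivity)
  · refine Real.exp_le_exp.2 ?_
    have h2 : (k : ℝ) ^ 2 ≤ ‖z‖ ^ 2 / t := by
      calc (k : ℝ) ^ 2 ≤ (‖z‖ / √t) ^ 2 := by gcongr
        _ = _ := by rw [div_pow, Real.sq_sqrt ht.le]
    have h3 : -‖z‖ ^ 2 / (4 * t) = -(‖z‖ ^ 2 / t) / 4 := by field_simp
    rw [h3]
    nlinarith [sq_nonneg ((k : ℝ) - 2)]

/-- Sum the ball bounds over radii $(k+1)\sqrt t$ against the weights $e^{1-k}$. Since $\beta\le d$,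
$(k+1)^\beta\le(k+1)^d$, so one constant serves every $\beta$. -/
lemma exists_heatFlow_le_of_ball_le (d : ℕ) :
    ∃ C : ℝ, 0 < C ∧ ∀ (f : EuclideanSpace ℝ (Fin d) → ℝ≥0∞), Measurable f →
      ∀ (β : ℝ) (N : ℝ≥0∞), β ≤ d →
        (∀ x, ∀ R : ℝ, 0 < R → ∫⁻ y in Metric.ball x R, f y ≤ ENNReal.ofReal (R ^ β) * N) →
        ∀ (t : ℝ) (x : EuclideanSpace ℝ (Fin d)), 0 < t →
          heatFlow f t x ≤ ENNReal.ofReal (C * t ^ ((β - d) / 2)) * N := by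
  have hsum : Summable fun k : ℕ => Real.exp (1 - k) * ((k : ℝ) + 1) ^ d := by
    have h := (summable_nat_add_iff 1).2 (Real.summable_pow_mul_exp_neg_nat_mul d one_pos)
    refine (h.mul_left (Real.exp 2)).congr fun k => ?_
    rw [mul_left_comm, ← Real.exp_add, mul_comm]
    push_cast
    ring_nf
  refine ⟨∑' k : ℕ, Real.exp (1 - k) * ((k : ℝ) + 1) ^ d,
    hsum.tsum_pos (fun k => by positivity) 0 (by positivity), fun f hf β N hβ hN t x ht => ?_⟩
  have hs : 0 < √t := Real.sqrt_pos.2 ht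
  calc heatFlow f t x
      ≤ ∫⁻ y, ∑' k : ℕ, (Metric.ball x ((k + 1) * √t)).indicator
          (fun y => ENNReal.ofReal (t ^ (-(d : ℝ) / 2) * Real.exp (1 - k)) * f y) y := by
        refine lintegral_mono fun y => ?_
        calc _ ≤ _ := mul_le_mul_left (heatKernel_le_tsum ht (x - y)) (f y)
          _ = _ := by
            rw [← ENNReal.tsum_mul_right]
            refine tsum_congr fun k => ?_
            have : x - y ∈ Metric.ball 0 ((k + 1) * √t) ↔ y ∈ Metric.ball x ((k + 1) * √t) := by
              rw [mem_ball_zero_iff, mem_ball_iff_norm']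
            by_cases h : y ∈ Metric.ball x ((k + 1) * √t)
            · rw [indicator_of_mem h, indicator_of_mem (this.2 h)]
            · rw [indicator_of_notMem h, indicator_of_notMem (fun h' => h (this.1 h')), zero_mul]
    _ = ∑' k : ℕ, ENNReal.ofReal (t ^ (-(d : ℝ) / 2) * Real.exp (1 - k))
          * ∫⁻ y in Metric.ball x ((k + 1) * √t), f y := by
        rw [lintegral_tsum fun k => ((hf.const_mul _).indicator measurableSet_ball).aemeasurable]
        refine tsum_congr fun k => ?_
        rw [lintegral_indicator measurableSet_ball, lintegral_const_mul _ hf]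
    _ ≤ ∑' k : ℕ, ENNReal.ofReal (t ^ ((β - d) / 2) * (Real.exp (1 - k) * ((k : ℝ) + 1) ^ d))
          * N := by
        refine ENNReal.tsum_le_tsum fun k => ?_
        refine (mul_le_mul_right (hN x _ (by positivity)) _).trans ?_
        rw [← mul_assoc, ← ENNReal.ofReal_mul (by positivity)]
        refine mul_le_mul_left (ENNReal.ofReal_le_ofReal ?_) N
        rw [Real.mul_rpow (by positivity) hs.le, Real.sqrt_eq_rpow, ← Real.rpow_mul ht.le]
        have e1 : t ^ ((β - d) / 2) = t ^ (-(d : ℝ) / 2) * t ^ (1 / 2 * β) := by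
          rw [← Real.rpow_add ht]; congr 1; ring
        have e2 : ((k : ℝ) + 1) ^ β ≤ ((k : ℝ) + 1) ^ d := by
          rw [← Real.rpow_natCast]
          exact Real.rpow_le_rpow_of_exponent_le (by simp) hβ
        calc _ = t ^ (-(d : ℝ) / 2) * t ^ (1 / 2 * β) * (Real.exp (1 - k) * ((k : ℝ) + 1) ^ β) := by
              ring
          _ ≤ _ := by rw [e1]; gcongr
    _ = _ := by
        rw [ENNReal.tsum_mul_right, ← ENNReal.ofReal_tsum_of_nonneg (fun k => by positivity)
          (hsum.mul_left _), tsum_mul_left, mul_comm (t ^ _)]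

end HeatKernel

/-! ### Monotonicity and size of the nonlinearity -/

section PowerNonlinearity

variable {p : ℝ}

lemma powerNonlinearity_neg (p v : ℝ) : powerNonlinearity p (-v) = -powerNonlinearity p v := by
  simp [powerNonlinearity]

lemma powerNonlinearity_nonneg (p : ℝ) {v : ℝ} (hv : 0 ≤ v) : 0 ≤ powerNonlinearity p v :=
  mul_nonneg (Real.rpow_nonneg (abs_nonneg _) _) hv

lemma monotone_powerNonlinearity (hp : 1 < p) : Monotone (powerNonlinearity p) := by
  have key : ∀ a b : ℝ, 0 ≤ a → a ≤ b → powerNonlinearity p a ≤ powerNonlinearity p b :=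
    fun a b ha hab => mul_le_mul (Real.rpow_le_rpow (abs_nonneg _)
      (by rwa [abs_of_nonneg ha, abs_of_nonneg (ha.trans hab)]) (by linarith)) hab ha
      (Real.rpow_nonneg (abs_nonneg _) _)
  intro a b hab
  rcases le_total 0 a with ha | ha
  · exact key a b ha hab
  rcases le_total 0 b with hb | hb
  · have h := powerNonlinearity_nonneg p (neg_nonneg.2 ha)
    rw [powerNonlinearity_neg] at h
    exact (neg_nonneg.1 h).trans (powerNonlinearity_nonneg p hb)
  · have h := key (-b) (-a) (neg_nonneg.2 hb) (neg_le_neg hab)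
    rw [powerNonlinearity_neg, powerNonlinearity_neg] at h
    exact neg_le_neg_iff.1 h

lemma continuous_powerNonlinearity (hp : 1 < p) : Continuous (powerNonlinearity p) :=
  (continuous_abs.rpow_const fun _ => Or.inr (by linarith)).mul continuous_id

lemma abs_powerNonlinearity (hp : 1 < p) (v : ℝ) : |powerNonlinearity p v| = |v| ^ p := by
  rw [powerNonlinearity, abs_mul, abs_of_nonneg (Real.rpow_nonneg (abs_nonneg _) _)]
  rcases (abs_nonneg v).eq_or_lt with h | h
  · rw [← h, mul_zero, Real.zero_rpow (by linarith)]
  · rw [← Real.rpow_add_one h.ne', sub_add_cancel]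

lemma abs_powerNonlinearity_le (hp : 1 < p) {v w : ℝ} (h : |v| ≤ w) :
    |powerNonlinearity p v| ≤ w ^ p := by
  rw [abs_powerNonlinearity hp]
  exact Real.rpow_le_rpow (abs_nonneg _) h (by linarith)

end PowerNonlinearity

/-! ### Majorants and mild solutions -/

section Duhamel

variable {d : ℕ}

/-- The Duhamel operator, whose fixed points are the mild solutions. -/
noncomputable def duhamelMap (p : ℝ) (u₀ : EuclideanSpace ℝ (Fin d) → ℝ)
    (v : ℝ → EuclideanSpace ℝ (Fin d) → ℝ) (t : ℝ) (x : EuclideanSpace ℝ (Fin d)) : ℝ :=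
  (∫ y, heatKernel t (x - y) * u₀ y)
      + ∫ z in Ioo (0 : ℝ) t ×ˢ (univ : Set (EuclideanSpace ℝ (Fin d))),
          heatKernel (t - z.1) (x - z.2) * powerNonlinearity p (v z.1 z.2)

/-- `w` dominates the Duhamel operator applied to everything that it dominates. -/
structure IsMajorant (p : ℝ) (u₀ : EuclideanSpace ℝ (Fin d) → ℝ)
    (w : ℝ → EuclideanSpace ℝ (Fin d) → ℝ) : Prop where
  measurable_init : Measurable u₀
  measurable : Measurable fun z : ℝ × EuclideanSpace ℝ (Fin d) => w z.1 z.2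
  nonneg : ∀ t x, 0 ≤ w t x
  integrable_init : ∀ t x, 0 < t → Integrable fun y => heatKernel t (x - y) * u₀ y
  integrableOn : ∀ t x, 0 < t → IntegrableOn (fun z : ℝ × EuclideanSpace ℝ (Fin d) =>
      heatKernel (t - z.1) (x - z.2) * w z.1 z.2 ^ p) (Ioo 0 t ×ˢ univ)
  le : ∀ t x, 0 < t → (∫ y, heatKernel t (x - y) * |u₀ y|)
      + ∫ z in Ioo (0 : ℝ) t ×ˢ (univ : Set (EuclideanSpace ℝ (Fin d))),
          heatKernel (t - z.1) (x - z.2) * w z.1 z.2 ^ p ≤ w t x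

lemma ae_restrict_slab {t : ℝ} {P : ℝ × EuclideanSpace ℝ (Fin d) → Prop}
    (h : ∀ z, 0 < z.1 → z.1 < t → P z) :
    ∀ᵐ z ∂volume.restrict (Ioo (0 : ℝ) t ×ˢ (univ : Set (EuclideanSpace ℝ (Fin d)))), P z := by
  filter_upwards [ae_restrict_mem (measurableSet_Ioo.prod MeasurableSet.univ)] with z hz
    using h z hz.1.1 hz.1.2

lemma measurable_duhamelMap {p : ℝ} (hp : 1 < p) {u₀ : EuclideanSpace ℝ (Fin d) → ℝ}
    {v : ℝ → EuclideanSpace ℝ (Fin d) → ℝ} (hu₀ : Measurable u₀)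
    (hv : Measurable fun z : ℝ × EuclideanSpace ℝ (Fin d) => v z.1 z.2) :
    Measurable fun z : ℝ × EuclideanSpace ℝ (Fin d) => duhamelMap p u₀ v z.1 z.2 := by
  have hF := (continuous_powerNonlinearity hp).measurable
  unfold duhamelMap
  refine Measurable.add ?_ ?_
  · have h : Measurable fun w : (ℝ × EuclideanSpace ℝ (Fin d)) × EuclideanSpace ℝ (Fin d) =>
        heatKernel w.1.1 (w.1.2 - w.2) * u₀ w.2 := by fun_prop
    exact h.stronglyMeasurable.integral_prod_right'.measurable
  -- The domain of integration depends on $t$; an indicator on the product space makes this a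
  -- parametric integral over a fixed space.
  · have h : Measurable fun w : (ℝ × EuclideanSpace ℝ (Fin d)) × (ℝ × EuclideanSpace ℝ (Fin d)) =>
        {w : (ℝ × EuclideanSpace ℝ (Fin d)) × (ℝ × EuclideanSpace ℝ (Fin d)) |
          0 < w.2.1 ∧ w.2.1 < w.1.1}.indicator (fun w => heatKernel (w.1.1 - w.2.1) (w.1.2 - w.2.2)
            * powerNonlinearity p (v w.2.1 w.2.2)) w := by
      refine Measurable.indicator ?_ ?_
      · exact Measurable.mul (by fun_prop) (hF.comp (hv.comp measurable_snd))
      · exact (measurableSet_lt measurable_const (measurable_fst.comp measurable_snd)).inter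
          (measurableSet_lt (measurable_fst.comp measurable_snd)
            (measurable_fst.comp measurable_fst))
    have h' := (h.stronglyMeasurable.integral_prod_right'
      (ν := (volume : Measure (ℝ × EuclideanSpace ℝ (Fin d))))).measurable
    convert h' using 2 with z
    rw [← integral_indicator (measurableSet_Ioo.prod MeasurableSet.univ)]
    refine integral_congr_ae (Filter.Eventually.of_forall fun ζ => ?_)
    simp [indicator]

namespace IsMajorant

variable {p : ℝ} {u₀ : EuclideanSpace ℝ (Fin d) → ℝ}
  {w v v' : ℝ → EuclideanSpace ℝ (Fin d) → ℝ}

lemma integrableOn_duhamel (hw : IsMajorant p u₀ w) (hp : 1 < p)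
    (hv : Measurable fun z : ℝ × EuclideanSpace ℝ (Fin d) => v z.1 z.2)
    (hvw : ∀ t x, 0 < t → |v t x| ≤ w t x) {t : ℝ} (ht : 0 < t) (x : EuclideanSpace ℝ (Fin d)) :
    IntegrableOn (fun z : ℝ × EuclideanSpace ℝ (Fin d) =>
      heatKernel (t - z.1) (x - z.2) * powerNonlinearity p (v z.1 z.2)) (Ioo 0 t ×ˢ univ) := by
  have hF := (continuous_powerNonlinearity hp).measurable
  refine (hw.integrableOn t x ht).mono'
    (Measurable.mul (by fun_prop) (hF.comp hv)).aestronglyMeasurable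
    (ae_restrict_slab fun z hz hzt => ?_)
  have hk := (heatKernel_pos (sub_pos.2 hzt) (x - z.2)).le
  rw [norm_mul, Real.norm_of_nonneg hk, Real.norm_eq_abs]
  exact mul_le_mul_of_nonneg_left (abs_powerNonlinearity_le hp (hvw _ _ hz)) hk

lemma duhamelMap_mono (hw : IsMajorant p u₀ w) (hp : 1 < p)
    (hv : Measurable fun z : ℝ × EuclideanSpace ℝ (Fin d) => v z.1 z.2)
    (hvw : ∀ t x, 0 < t → |v t x| ≤ w t x)
    (hv' : Measurable fun z : ℝ × EuclideanSpace ℝ (Fin d) => v' z.1 z.2)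
    (hvw' : ∀ t x, 0 < t → |v' t x| ≤ w t x) (hle : ∀ t x, 0 < t → v t x ≤ v' t x)
    {t : ℝ} (ht : 0 < t) (x : EuclideanSpace ℝ (Fin d)) :
    duhamelMap p u₀ v t x ≤ duhamelMap p u₀ v' t x := by
  refine add_le_add le_rfl (integral_mono_ae (hw.integrableOn_duhamel hp hv hvw ht x)
    (hw.integrableOn_duhamel hp hv' hvw' ht x) (ae_restrict_slab fun z hz hzt => ?_))
  exact mul_le_mul_of_nonneg_left (monotone_powerNonlinearity hp (hle _ _ hz))
    (heatKernel_pos (sub_pos.2 hzt) (x - z.2)).le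

lemma abs_duhamelMap_le (hw : IsMajorant p u₀ w) (hp : 1 < p)
    (hvw : ∀ t x, 0 < t → |v t x| ≤ w t x) {t : ℝ} (ht : 0 < t) (x : EuclideanSpace ℝ (Fin d)) :
    |duhamelMap p u₀ v t x| ≤ w t x := by
  refine (abs_add_le _ _).trans ((add_le_add ?_ ?_).trans (hw.le t x ht))
  · refine abs_integral_le_integral_abs.trans_eq (integral_congr_ae
      (Filter.Eventually.of_forall fun y => ?_))
    simp only [abs_mul, abs_of_pos (heatKernel_pos ht (x - y))]
  · rw [← Real.norm_eq_abs]
    refine norm_integral_le_of_norm_le (hw.integrableOn t x ht)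
      (ae_restrict_slab fun z hz hzt => ?_)
    have hk := (heatKernel_pos (sub_pos.2 hzt) (x - z.2)).le
    rw [norm_mul, Real.norm_of_nonneg hk, Real.norm_eq_abs]
    exact mul_le_mul_of_nonneg_left (abs_powerNonlinearity_le hp (hvw _ _ hz)) hk

lemma duhamelMap_nonneg (hu₀ : ∀ᵐ x, 0 ≤ u₀ x) (hv : ∀ t x, 0 < t → 0 ≤ v t x) {t : ℝ}
    (ht : 0 < t) (x : EuclideanSpace ℝ (Fin d)) : 0 ≤ duhamelMap p u₀ v t x := by
  refine add_nonneg (integral_nonneg_of_ae ?_)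
    (integral_nonneg_of_ae (ae_restrict_slab fun z hz hzt => ?_))
  · filter_upwards [hu₀] with y hy using mul_nonneg (heatKernel_pos ht _).le hy
  · exact mul_nonneg (heatKernel_pos (sub_pos.2 hzt) (x - z.2)).le
      (powerNonlinearity_nonneg p (hv _ _ hz))

/-- The iterates of the Duhamel map starting from $w$ decrease and stay in $[-w,w]$, and dominated
convergence with dominating function $w^p$ times the kernel passes to the limit. Starting at the top
gives monotonicity for sign-changing data too, where starting from $0$ would not. -/
theorem exists_fixedPoint (hw : IsMajorant p u₀ w) (hp : 1 < p) :
    ∃ u : ℝ → EuclideanSpace ℝ (Fin d) → ℝ,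
      (Measurable fun z : ℝ × EuclideanSpace ℝ (Fin d) => u z.1 z.2) ∧
      (∀ t x, 0 < t → |u t x| ≤ w t x) ∧
      (∀ t x, 0 < t → u t x = duhamelMap p u₀ u t x) ∧
      ((∀ᵐ x, 0 ≤ u₀ x) → ∀ t x, 0 < t → 0 ≤ u t x) := by
  have hF := continuous_powerNonlinearity hp
  let v : ℕ → ℝ → EuclideanSpace ℝ (Fin d) → ℝ :=
    fun n => Nat.rec w (fun _ f => duhamelMap p u₀ f) n
  have hvs : ∀ n, v (n + 1) = duhamelMap p u₀ (v n) := fun n => rfl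
  have hm : ∀ n, Measurable fun z : ℝ × EuclideanSpace ℝ (Fin d) => v n z.1 z.2 := by
    intro n
    induction n with
    | zero => exact hw.measurable
    | succ n ih => exact measurable_duhamelMap hp hw.measurable_init ih
  have hb : ∀ n t x, 0 < t → |v n t x| ≤ w t x := by
    intro n
    induction n with
    | zero => exact fun t x _ => (abs_of_nonneg (hw.nonneg t x)).le
    | succ n ih => exact fun t x ht => hw.abs_duhamelMap_le hp ih ht x
  have hanti : ∀ n t x, 0 < t → v (n + 1) t x ≤ v n t x := by
    intro n
    induction n with
    | zero => exact fun t x ht => (le_abs_self _).trans (hb 1 t x ht)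
    | succ n ih => exact fun t x ht => 
        hw.duhamelMap_mono hp (hm (n + 1)) (hb (n + 1)) (hm n) (hb n) ih ht x
  have hbdd : ∀ t x, 0 < t → BddBelow (range fun n => v n t x) := fun t x ht =>
    ⟨-w t x, by rintro _ ⟨n, rfl⟩; exact (abs_le.1 (hb n t x ht)).1⟩
  let u : ℝ → EuclideanSpace ℝ (Fin d) → ℝ := fun t x => ⨅ n, v n t x
  have hlim : ∀ t x, 0 < t → Filter.Tendsto (fun n => v n t x) Filter.atTop (nhds (u t x)) :=
    fun t x ht => tendsto_atTop_ciInf (antitone_nat_of_succ_le fun n => hanti n t x ht)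
      (hbdd t x ht)
  refine ⟨u, Measurable.iInf hm, fun t x ht => ?_, fun t x ht => ?_, fun hu₀ t x ht => ?_⟩
  · exact le_of_tendsto (hlim t x ht).abs (Filter.Eventually.of_forall fun n => hb n t x ht)
  · refine tendsto_nhds_unique ((hlim t x ht).comp (Filter.tendsto_add_atTop_nat 1)) ?_
    refine Filter.Tendsto.add tendsto_const_nhds ?_
    refine tendsto_integral_of_dominated_convergence _
      (fun n => (hw.integrableOn_duhamel hp (hm n) (hb n) ht x).aestronglyMeasurable)
      (hw.integrableOn t x ht) (fun n => ae_restrict_slab fun z hz hzt => ?_)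
      (ae_restrict_slab fun z hz hzt => ?_)
    · have hk := (heatKernel_pos (sub_pos.2 hzt) (x - z.2)).le
      rw [norm_mul, Real.norm_of_nonneg hk, Real.norm_eq_abs]
      exact mul_le_mul_of_nonneg_left (abs_powerNonlinearity_le hp (hb _ _ _ hz)) hk
    · exact tendsto_const_nhds.mul ((hF.tendsto _).comp (hlim _ _ hz))
  · have hn : ∀ n t x, 0 < t → 0 ≤ v n t x := by
      intro n
      induction n with
      | zero => exact fun t x _ => hw.nonneg t x
      | succ n ih => exact fun t x ht => duhamelMap_nonneg hu₀ ih ht x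
    exact le_ciInf fun n => hn n t x ht

end IsMajorant

/-- The power mean `(e^{tΔ} |u₀|^r)^{1/r}`. -/
noncomputable def heatMean (r : ℝ) (u₀ : EuclideanSpace ℝ (Fin d) → ℝ) (t : ℝ)
    (x : EuclideanSpace ℝ (Fin d)) : ℝ≥0∞ :=
  heatFlow (fun y => ‖u₀ y‖ₑ ^ r) t x ^ (1 / r)

lemma heatMean_rpow {r : ℝ} (hr : 0 < r) (u₀ : EuclideanSpace ℝ (Fin d) → ℝ) (t : ℝ)
    (x : EuclideanSpace ℝ (Fin d)) :
    heatMean r u₀ t x ^ r = heatFlow (fun y => ‖u₀ y‖ₑ ^ r) t x := by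
  rw [heatMean, ← ENNReal.rpow_mul, one_div_mul_cancel hr.ne', ENNReal.rpow_one]

lemma measurable_heatMean {r : ℝ} {u₀ : EuclideanSpace ℝ (Fin d) → ℝ} (hu₀ : Measurable u₀) :
    Measurable fun z : ℝ × EuclideanSpace ℝ (Fin d) => heatMean r u₀ z.1 z.2 :=
  (measurable_heatFlow (by fun_prop)).pow_const _

lemma lintegral_Ioo_rpow {t γ : ℝ} (ht : 0 < t) (hγ : -1 < γ) :
    ∫⁻ τ in Ioo 0 t, ENNReal.ofReal (τ ^ γ) = ENNReal.ofReal (t ^ (γ + 1) / (γ + 1)) := by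
  have hint : IntegrableOn (fun τ : ℝ => τ ^ γ) (Ioo 0 t) :=
    ((intervalIntegrable_iff_integrableOn_Ioo_of_le ht.le).1
      (intervalIntegral.intervalIntegrable_rpow' hγ))
  rw [← ofReal_integral_eq_lintegral_ofReal hint, ← integral_Ioc_eq_integral_Ioo,
    ← intervalIntegral.integral_of_le ht.le, integral_rpow (Or.inl hγ),
    Real.zero_rpow (by linarith), sub_zero]
  filter_upwards [ae_restrict_mem measurableSet_Ioo] with τ hτ using Real.rpow_nonneg hτ.1.le _

/-- Split $W^p=W^rW^{p-r}$ and bound the second factor by its decay in time. The first is a heat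
flow, so convolving from $\tau$ to $t$ gives $W(t)^r$ for every $\tau$, and only a power of $\tau$
remains to integrate. Splitting $W(t)^r=W(t)\,W(t)^{r-1}$ again cancels all powers of $t$. -/
lemma lintegral_heatKernel_mul_heatMean_rpow_le {p r κ : ℝ} (hr : 1 < r) (hrp : r ≤ p)
    (hκ : 0 < κ) {u₀ : EuclideanSpace ℝ (Fin d) → ℝ} (hu₀ : Measurable u₀)
    (hW : ∀ t x, 0 < t → heatMean r u₀ t x ≤ ENNReal.ofReal (κ * t ^ (-1 / (p - 1))))
    {t : ℝ} (ht : 0 < t) (x : EuclideanSpace ℝ (Fin d)) :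
    ∫⁻ z in Ioo (0 : ℝ) t ×ˢ (univ : Set (EuclideanSpace ℝ (Fin d))),
        ENNReal.ofReal (heatKernel (t - z.1) (x - z.2)) * heatMean r u₀ z.1 z.2 ^ p
      ≤ ENNReal.ofReal (κ ^ (p - 1) * ((p - 1) / (r - 1))) * heatMean r u₀ t x := by
  have hp1 : 0 < p - 1 := by linarith
  have hr1 : 0 < r - 1 := by linarith
  have hf : Measurable fun y => ‖u₀ y‖ₑ ^ r := by fun_prop
  have hWm := measurable_heatMean (r := r) hu₀
  have split : ∀ (a : ℝ), r ≤ a → ∀ τ y, 0 < τ → heatMean r u₀ τ y ^ a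
      ≤ heatFlow (fun y => ‖u₀ y‖ₑ ^ r) τ y
        * ENNReal.ofReal (κ ^ (a - r) * τ ^ (-1 / (p - 1) * (a - r))) := by
    intro a ha τ y hτ
    rw [← heatMean_rpow (by linarith)]
    conv_lhs => rw [show a = r + (a - r) by ring]
    rw [ENNReal.rpow_add_of_nonneg _ _ (by linarith) (by linarith)]
    refine mul_le_mul_right ?_ _
    refine (ENNReal.rpow_le_rpow (hW τ y hτ) (by linarith)).trans_eq ?_
    rw [ENNReal.ofReal_rpow_of_nonneg (by positivity) (by linarith),
      Real.mul_rpow hκ.le (by positivity), ← Real.rpow_mul hτ.le]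
  rw [Measure.volume_eq_prod, ← Measure.prod_restrict, Measure.restrict_univ,
    lintegral_prod _ (by fun_prop)]
  -- Integrability at $\tau=0$ is exactly the condition $r>1$.
  have hγ : -1 < -1 / (p - 1) * (p - r) := by
    rw [div_mul_eq_mul_div, lt_div_iff₀ hp1]; linarith
  calc _ ≤ ∫⁻ τ in Ioo 0 t, heatFlow (fun y => ‖u₀ y‖ₑ ^ r) t x
          * (ENNReal.ofReal (κ ^ (p - r)) * ENNReal.ofReal (τ ^ (-1 / (p - 1) * (p - r)))) := by
        refine setLIntegral_mono' measurableSet_Ioo fun τ hτ => ?_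
        rw [← ENNReal.ofReal_mul (by positivity)]
        calc _ ≤ ∫⁻ y, ENNReal.ofReal (heatKernel (t - τ) (x - y))
                * (heatFlow (fun y => ‖u₀ y‖ₑ ^ r) τ y
                  * ENNReal.ofReal (κ ^ (p - r) * τ ^ (-1 / (p - 1) * (p - r)))) :=
              lintegral_mono fun y => mul_le_mul_right (split p hrp τ y hτ.1) _
          _ = heatFlow (heatFlow (fun y => ‖u₀ y‖ₑ ^ r) τ) (t - τ) x
                * ENNReal.ofReal (κ ^ (p - r) * τ ^ (-1 / (p - 1) * (p - r))) := by
              simp_rw [← mul_assoc]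
              rw [lintegral_mul_const' _ _ ENNReal.ofReal_ne_top]
              rfl
          _ = _ := by rw [heatFlow_heatFlow hf (sub_pos.2 hτ.2) hτ.1, sub_add_cancel]
    _ = heatMean r u₀ t x ^ r * (ENNReal.ofReal (κ ^ (p - r)) * ENNReal.ofReal
          (t ^ (-1 / (p - 1) * (p - r) + 1) / (-1 / (p - 1) * (p - r) + 1))) := by
        rw [heatMean_rpow (by linarith), lintegral_const_mul _ (by fun_prop),
          lintegral_const_mul _ (by fun_prop), lintegral_Ioo_rpow ht hγ]
    _ ≤ heatMean r u₀ t x * ENNReal.ofReal (κ ^ (r - 1) * t ^ (-1 / (p - 1) * (r - 1)))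
          * (ENNReal.ofReal (κ ^ (p - r)) * ENNReal.ofReal
          (t ^ (-1 / (p - 1) * (p - r) + 1) / (-1 / (p - 1) * (p - r) + 1))) := by
        refine mul_le_mul_left ?_ _
        conv_lhs => rw [show r = 1 + (r - 1) by ring]
        rw [ENNReal.rpow_add_of_nonneg _ _ zero_le_one hr1.le, ENNReal.rpow_one]
        rw [add_sub_cancel]
        refine mul_le_mul_right ((ENNReal.rpow_le_rpow (hW t x ht) hr1.le).trans_eq ?_) _
        rw [ENNReal.ofReal_rpow_of_nonneg (by positivity) hr1.le,
          Real.mul_rpow hκ.le (by positivity), ← Real.rpow_mul ht.le]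
    _ = _ := by
        rw [mul_assoc, mul_comm, ← ENNReal.ofReal_mul (by positivity),
          ← ENNReal.ofReal_mul (by positivity)]
        congr 2
        have e1 : -1 / (p - 1) * (p - r) + 1 = (r - 1) / (p - 1) := by field_simp; ring
        have e2 : -1 / (p - 1) * (r - 1) = -((r - 1) / (p - 1)) := by ring
        have e3 : κ ^ (p - 1) = κ ^ (r - 1) * κ ^ (p - r) := by
          rw [← Real.rpow_add hκ]; congr 1; ring
        have hs : t ^ ((r - 1) / (p - 1)) ≠ 0 := (Real.rpow_pos_of_pos ht _).ne'
        rw [e1, e2, e3, Real.rpow_neg ht.le]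
        field_simp

/-- Half of $2W$ pays for the linear term (Jensen), the other half for the Duhamel term of $(2W)^p$,
which accounts for the factor $2^p$ in the smallness condition. -/
theorem isMajorant_heatMean {p r κ : ℝ} (hr : 1 < r) (hrp : r ≤ p)
    (hκ : 0 < κ) (hκs : 2 ^ p * (κ ^ (p - 1) * ((p - 1) / (r - 1))) ≤ 1)
    {u₀ : EuclideanSpace ℝ (Fin d) → ℝ} (hu₀ : Measurable u₀)
    (hW : ∀ t x, 0 < t → heatMean r u₀ t x ≤ ENNReal.ofReal (κ * t ^ (-1 / (p - 1)))) :
    IsMajorant p u₀ fun t x => 2 * (heatMean r u₀ t x).toReal := by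
  have hWm := measurable_heatMean (r := r) hu₀
  have hfin : ∀ t x, 0 < t → heatMean r u₀ t x ≠ ⊤ := fun t x ht =>
    ((hW t x ht).trans_lt ENNReal.ofReal_lt_top).ne
  have hp0 : 0 < p := by linarith
  have hlin : ∀ t x, 0 < t → ∫⁻ y, ENNReal.ofReal (heatKernel t (x - y) * |u₀ y|)
      ≤ heatMean r u₀ t x := by
    intro t x ht
    have h := heatFlow_rpow_le hu₀ ht one_pos hr.le x
    simp only [ENNReal.rpow_one, div_one] at h
    refine le_trans (le_of_eq (lintegral_congr fun y => ?_)) h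
    rw [ENNReal.ofReal_mul (heatKernel_pos ht _).le, ← Real.norm_eq_abs, ofReal_norm]
  have hduh : ∀ t x, 0 < t → ∫⁻ z in Ioo (0 : ℝ) t ×ˢ (univ : Set (EuclideanSpace ℝ (Fin d))),
      ENNReal.ofReal (heatKernel (t - z.1) (x - z.2) * (2 * (heatMean r u₀ z.1 z.2).toReal) ^ p)
        ≤ heatMean r u₀ t x := by
    intro t x ht
    calc _ = ∫⁻ z in Ioo (0 : ℝ) t ×ˢ (univ : Set (EuclideanSpace ℝ (Fin d))),
          ENNReal.ofReal (2 ^ p) * (ENNReal.ofReal (heatKernel (t - z.1) (x - z.2))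
            * heatMean r u₀ z.1 z.2 ^ p) := by
          refine lintegral_congr_ae (ae_restrict_slab fun z hz hzt => ?_)
          simp only
          rw [ENNReal.ofReal_mul (heatKernel_pos (sub_pos.2 hzt) _).le,
            Real.mul_rpow zero_le_two ENNReal.toReal_nonneg, ENNReal.ofReal_mul (by positivity),
            ← ENNReal.ofReal_rpow_of_nonneg ENNReal.toReal_nonneg hp0.le,
            ENNReal.ofReal_toReal (hfin _ _ hz)]
          ring
      _ ≤ ENNReal.ofReal (2 ^ p) * (ENNReal.ofReal (κ ^ (p - 1) * ((p - 1) / (r - 1)))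
            * heatMean r u₀ t x) := by
          rw [lintegral_const_mul' _ _ ENNReal.ofReal_ne_top]
          exact mul_le_mul_right
            (lintegral_heatKernel_mul_heatMean_rpow_le hr hrp hκ hu₀ hW ht x) _
      _ ≤ 1 * heatMean r u₀ t x := by
          rw [← mul_assoc, ← ENNReal.ofReal_mul (by positivity)]
          refine mul_le_mul_left ?_ _
          rw [← ENNReal.ofReal_one]
          exact ENNReal.ofReal_le_ofReal hκs
      _ = _ := one_mul _
  have hmeas : ∀ t x, Measurable fun z : ℝ × EuclideanSpace ℝ (Fin d) =>
      heatKernel (t - z.1) (x - z.2) * (2 * (heatMean r u₀ z.1 z.2).toReal) ^ p := by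
    intro t x; fun_prop
  have hnn : ∀ t x, 0 ≤ᵐ[volume.restrict (Ioo (0 : ℝ) t ×ˢ
      (univ : Set (EuclideanSpace ℝ (Fin d))))] fun z : ℝ × EuclideanSpace ℝ (Fin d) =>
      heatKernel (t - z.1) (x - z.2) * (2 * (heatMean r u₀ z.1 z.2).toReal) ^ p :=
    fun t x => ae_restrict_slab fun z hz hzt => mul_nonneg
      (heatKernel_pos (sub_pos.2 hzt) _).le (by positivity)
  have hnn' : ∀ t x, 0 < t → 0 ≤ᵐ[volume] fun y => heatKernel t (x - y) * |u₀ y| :=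
    fun t x ht => Filter.Eventually.of_forall fun y =>
      mul_nonneg (heatKernel_pos ht _).le (abs_nonneg _)
  refine ⟨hu₀, by fun_prop, fun t x => by positivity, fun t x ht => ?_, fun t x ht => ?_,
    fun t x ht => ?_⟩
  · have : Integrable fun y => heatKernel t (x - y) * |u₀ y| :=
      (lintegral_ofReal_ne_top_iff_integrable (by fun_prop) (hnn' t x ht)).1
        ((hlin t x ht).trans_lt (hfin t x ht).lt_top).ne
    refine this.mono (by fun_prop) (Filter.Eventually.of_forall fun y => ?_)
    simp
  · exact (lintegral_ofReal_ne_top_iff_integrable (hmeas t x).aestronglyMeasurable (hnn t x)).1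
      ((hduh t x ht).trans_lt (hfin t x ht).lt_top).ne
  · rw [integral_eq_lintegral_of_nonneg_ae (hnn' t x ht) (by fun_prop),
      integral_eq_lintegral_of_nonneg_ae (hnn t x) (hmeas t x).aestronglyMeasurable, two_mul]
    exact add_le_add (ENNReal.toReal_mono (hfin t x ht) (hlin t x ht))
      (ENNReal.toReal_mono (hfin t x ht) (hduh t x ht))

end Duhamel

/-! ### The heat kernel as a fundamental solution -/

section FundamentalSolution

variable {d : ℕ}

lemma continuous_heatKernel_one :
    Continuous fun z : EuclideanSpace ℝ (Fin d) => heatKernel 1 z := by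
  unfold heatKernel
  fun_prop

lemma heatKernel_sqrt_smul {t : ℝ} (ht : 0 < t) (z : EuclideanSpace ℝ (Fin d)) :
    heatKernel t (√t • z) = (√t ^ d)⁻¹ * heatKernel 1 z := by
  unfold heatKernel
  rw [norm_smul, Real.norm_of_nonneg (Real.sqrt_nonneg t), mul_pow, Real.sq_sqrt ht.le,
    ← mul_assoc]
  congr 1
  · rw [Real.mul_rpow (by positivity) ht.le, mul_one, mul_comm, neg_div, Real.rpow_neg ht.le,
      Real.sqrt_eq_rpow, ← Real.rpow_natCast (t ^ (1 / 2 : ℝ)), ← Real.rpow_mul ht.le]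
    ring_nf
  · congr 1
    field_simp

/-- Moves the time dependence from the kernel to the smooth function, so that differentiating in $t$
meets no singular kernel. -/
lemma integral_heatKernel_mul_eq {t : ℝ} (ht : 0 < t) (f : EuclideanSpace ℝ (Fin d) → ℝ)
    (y : EuclideanSpace ℝ (Fin d)) :
    ∫ x, heatKernel t (x - y) * f x = ∫ z, heatKernel 1 z * f (y + √t • z) := by
  have h1 := integral_add_left_eq_self (μ := volume) (fun x => heatKernel t (x - y) * f x) y
  have h2 := Measure.integral_comp_smul volume (fun x => heatKernel t (y + x - y) * f (y + x)) (√t)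
  have hs : 0 < √t ^ d := pow_pos (Real.sqrt_pos.2 ht) d
  rw [← h1]
  simp only [add_sub_cancel_left, heatKernel_sqrt_smul ht, finrank_euclideanSpace_fin,
    abs_of_pos (inv_pos.2 hs), mul_assoc, integral_const_mul, smul_eq_mul] at h2 ⊢
  exact (mul_left_cancel₀ (inv_pos.2 hs).ne' h2).symm

/-- The factor $\|z\|$ is absorbed by $e^{\|z\|^2/8}$, which only widens the Gaussian from time $1$
to time $2$. -/
lemma norm_mul_heatKernel_one_le (z : EuclideanSpace ℝ (Fin d)) :
    ‖z‖ * heatKernel 1 z ≤ 2 * (2 ^ ((d : ℝ) / 2) * heatKernel 2 z) := by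
  have h1 : ‖z‖ ≤ 2 * Real.exp (‖z‖ ^ 2 / 8) := by
    nlinarith [Real.add_one_le_exp (‖z‖ ^ 2 / 8), sq_nonneg (‖z‖ / 2 - 1)]
  have h2 : Real.exp (‖z‖ ^ 2 / 8) * heatKernel 1 z = 2 ^ ((d : ℝ) / 2) * heatKernel 2 z := by
    unfold heatKernel
    rw [mul_left_comm, ← Real.exp_add, ← mul_assoc (2 ^ ((d : ℝ) / 2) : ℝ),
      Real.mul_rpow (y := 2) (by positivity) zero_le_two, mul_comm (_ ^ _) (2 ^ (-(d : ℝ) / 2)),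
      ← mul_assoc (2 ^ ((d : ℝ) / 2) : ℝ), ← Real.rpow_add two_pos]
    rw [show (d : ℝ) / 2 + -d / 2 = 0 by ring, Real.rpow_zero, one_mul, mul_one]
    congr 2
    ring
  calc _ ≤ 2 * Real.exp (‖z‖ ^ 2 / 8) * heatKernel 1 z :=
        mul_le_mul_of_nonneg_right h1 (heatKernel_pos one_pos z).le
    _ = _ := by rw [mul_assoc, h2]

lemma integrable_norm_mul_heatKernel_one :
    Integrable fun z : EuclideanSpace ℝ (Fin d) => ‖z‖ * heatKernel 1 z := by
  refine (((integrable_heatKernel two_pos).const_mul (2 ^ ((d : ℝ) / 2))).const_mul 2).mono'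
    (by fun_prop) (Filter.Eventually.of_forall fun z => ?_)
  rw [Real.norm_of_nonneg (mul_nonneg (norm_nonneg _) (heatKernel_pos one_pos z).le)]
  exact norm_mul_heatKernel_one_le z

lemma integrable_heatKernel_one_mul {f : EuclideanSpace ℝ (Fin d) → ℝ} (hf : Continuous f) {M : ℝ}
    (hM : ∀ z, |f z| ≤ M) : Integrable fun z => heatKernel 1 z * f z := by
  refine ((integrable_heatKernel one_pos).mul_const M).mono'
    (continuous_heatKernel_one.mul hf).aestronglyMeasurable (Filter.Eventually.of_forall fun z => ?_)
  rw [norm_mul, Real.norm_of_nonneg (heatKernel_pos one_pos z).le]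
  exact mul_le_mul_of_nonneg_left (hM z) (heatKernel_pos one_pos z).le

lemma hasFDerivAt_heatKernel_one (z : EuclideanSpace ℝ (Fin d)) :
    HasFDerivAt (fun z : EuclideanSpace ℝ (Fin d) => heatKernel 1 z)
      ((-(1 / 2) * heatKernel 1 z) • innerSL ℝ z) z := by
  have h := ((((hasStrictFDerivAt_norm_sq z).hasFDerivAt.const_mul (-(1 / 4))).exp).const_mul
    ((4 * Real.pi * 1) ^ (-(d : ℝ) / 2)))
  refine (h.congr_of_eventuallyEq (Filter.Eventually.of_forall fun w => ?_)).congr_fderiv ?_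
  · simp only [heatKernel]
    congr 2
    ring
  · ext v
    simp only [heatKernel, smul_apply, smul_eq_mul, nsmul_eq_mul]
    rw [show -‖z‖ ^ 2 / (4 * 1) = -(1 / 4) * ‖z‖ ^ 2 by ring]
    push_cast
    ring

variable {φ : ℝ × EuclideanSpace ℝ (Fin d) → ℝ}

lemma hasFDerivAt_comp_affine {ψ : ℝ × EuclideanSpace ℝ (Fin d) → ℝ} (hψ : Differentiable ℝ ψ)
    (s c : ℝ) (y z : EuclideanSpace ℝ (Fin d)) :
    HasFDerivAt (fun z => ψ (s, y + c • z)) ((fderiv ℝ ψ (s, y + c • z)).comp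
      ((0 : EuclideanSpace ℝ (Fin d) →L[ℝ] ℝ).prod
        (c • ContinuousLinearMap.id ℝ (EuclideanSpace ℝ (Fin d))))) z := by
  refine (hψ _).hasFDerivAt.comp z (f := fun z => (s, y + c • z)) ?_
  exact (hasFDerivAt_const s z).prodMk (((hasFDerivAt_id z).const_smul c).const_add y)

/-- Gaussian integration by parts: $z_iG=-2\,\partial_iG$ for $G$ the kernel at time $1$, and each
derivative landing on $\varphi$ yields a factor $c$. -/
lemma integral_heatKernel_one_mul_fderiv (hφ : ContDiff ℝ ∞ φ) (hc : HasCompactSupport φ)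
    (s c : ℝ) (y : EuclideanSpace ℝ (Fin d)) :
    ∫ z, heatKernel 1 z * fderiv ℝ φ (s, y + c • z) (0, z)
      = 2 * c * ∫ z, heatKernel 1 z * ∑ i : Fin d,
        fderiv ℝ (fun w => fderiv ℝ φ w (0, EuclideanSpace.single i 1)) (s, y + c • z)
          (0, EuclideanSpace.single i 1) := by
  have hP : Continuous fun z : EuclideanSpace ℝ (Fin d) => (s, y + c • z) := by fun_prop
  set e : Fin d → EuclideanSpace ℝ (Fin d) := fun i => EuclideanSpace.single i 1
  have hb1 : ∀ i, ∃ M, ∀ w, |fderiv ℝ φ w (0, e i)| ≤ M := fun i =>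
    (hc.fderiv_apply_const _).exists_bound_of_continuous (hφ.fderiv_apply_const _).continuous
  have hb2 : ∀ i, ∃ M, ∀ w, |fderiv ℝ (fun w => fderiv ℝ φ w (0, e i)) w (0, e i)| ≤ M := fun i =>
    ((hc.fderiv_apply_const _).fderiv_apply_const _).exists_bound_of_continuous
      ((hφ.fderiv_apply_const _).fderiv_apply_const _).continuous
  have hc1 : ∀ i, Continuous fun z => fderiv ℝ φ (s, y + c • z) (0, e i) :=
    fun i => (hφ.fderiv_apply_const _).continuous.comp hP
  have hc2 : ∀ i, Continuous fun z =>
      fderiv ℝ (fun w => fderiv ℝ φ w (0, e i)) (s, y + c • z) (0, e i) :=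
    fun i => ((hφ.fderiv_apply_const _).fderiv_apply_const _).continuous.comp hP
  have hi2 : ∀ i, Integrable fun z => heatKernel 1 z
      * fderiv ℝ (fun w => fderiv ℝ φ w (0, e i)) (s, y + c • z) (0, e i) := fun i => by
    obtain ⟨M, hM⟩ := hb2 i
    exact integrable_heatKernel_one_mul (hc2 i) fun z => hM _
  have hi1 : ∀ i, Integrable fun z => z i * heatKernel 1 z
      * fderiv ℝ φ (s, y + c • z) (0, e i) := fun i => by
    obtain ⟨M, hM⟩ := hb1 i
    refine (integrable_norm_mul_heatKernel_one.mul_const M).mono' ?_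
      (Filter.Eventually.of_forall fun z => ?_)
    · have := continuous_heatKernel_one (d := d)
      exact Continuous.aestronglyMeasurable (((by fun_prop : Continuous fun z :
        EuclideanSpace ℝ (Fin d) => z i).mul this).mul (hc1 i))
    · rw [norm_mul, norm_mul, Real.norm_of_nonneg (heatKernel_pos one_pos z).le]
      refine mul_le_mul (mul_le_mul_of_nonneg_right (PiLp.norm_apply_le z i)
        (heatKernel_pos one_pos z).le) (hM _) (norm_nonneg _)
        (mul_nonneg (norm_nonneg _) (heatKernel_pos one_pos z).le)
  have key : ∀ i, ∫ z, z i * heatKernel 1 z * fderiv ℝ φ (s, y + c • z) (0, e i)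
      = 2 * c * ∫ z, heatKernel 1 z
        * fderiv ℝ (fun w => fderiv ℝ φ w (0, e i)) (s, y + c • z) (0, e i) := by
    intro i
    have hd2 : ∀ z, fderiv ℝ (fun z => fderiv ℝ φ (s, y + c • z) (0, e i)) z (e i)
        = c * fderiv ℝ (fun w => fderiv ℝ φ w (0, e i)) (s, y + c • z) (0, e i) := by
      intro z
      rw [(hasFDerivAt_comp_affine ((hφ.fderiv_apply_const (0, e i)).differentiable (by simp))
        s c y z).fderiv]
      have : ((0, c • e i) : ℝ × EuclideanSpace ℝ (Fin d)) = c • (0, e i) := by simp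
      change fderiv ℝ (fun w => fderiv ℝ φ w (0, e i)) (s, y + c • z) (0, c • e i) = _
      rw [this, map_smul, smul_eq_mul]
    have hd1 : ∀ z : EuclideanSpace ℝ (Fin d),
        fderiv ℝ (fun z => heatKernel 1 z) z (e i) = -(1 / 2) * (z i * heatKernel 1 z) := by
      intro z
      rw [(hasFDerivAt_heatKernel_one z).fderiv]
      simp [e, EuclideanSpace.inner_single_right]
      ring
    have h := integral_mul_fderiv_eq_neg_fderiv_mul_of_integrable (μ := volume) (v := e i)
      (f := fun z => heatKernel 1 z) (g := fun z => fderiv ℝ φ (s, y + c • z) (0, e i))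
      (by simp only [hd1, mul_assoc]
          simpa only [mul_assoc] using (hi1 i).const_mul (-(1 / 2)))
      (by simp only [hd2]
          simpa only [mul_left_comm] using (hi2 i).const_mul c)
      (by obtain ⟨M, hM⟩ := hb1 i
          exact integrable_heatKernel_one_mul (hc1 i) fun z => hM _)
      (fun z _ => (hasFDerivAt_heatKernel_one z).differentiableAt)
      (fun z _ => (hasFDerivAt_comp_affine ((hφ.fderiv_apply_const (0, e i)).differentiable
        (by simp)) s c y z).differentiableAt)
    simp only [hd1, hd2, mul_left_comm _ c, mul_assoc, integral_const_mul] at h ⊢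
    linarith
  have expand : ∀ z : EuclideanSpace ℝ (Fin d), heatKernel 1 z * fderiv ℝ φ (s, y + c • z) (0, z)
      = ∑ i, z i * heatKernel 1 z * fderiv ℝ φ (s, y + c • z) (0, e i) := by
    intro z
    have hz : ((0, z) : ℝ × EuclideanSpace ℝ (Fin d)) = ∑ i, z i • (0, e i) := by
      have h1 := (EuclideanSpace.basisFun (Fin d) ℝ).sum_repr z
      simp only [EuclideanSpace.basisFun_repr, EuclideanSpace.basisFun_apply] at h1
      ext1
      · simp [Prod.fst_sum]
      · simp only [Prod.snd_sum, Prod.smul_snd]; exact h1.symm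
    conv_lhs => rw [hz, map_sum, Finset.mul_sum]
    refine Finset.sum_congr rfl fun i _ => ?_
    rw [map_smul, smul_eq_mul]
    ring
  simp only [expand, Finset.mul_sum]
  rw [integral_finsetSum _ fun i _ => hi1 i, integral_finsetSum _ fun i _ => hi2 i, Finset.mul_sum]
  exact Finset.sum_congr rfl fun i _ => key i

/-- The chain rule gives $\varphi_t+(2\sqrt t)^{-1}z\cdot\nabla\varphi$ under the integral; Gaussian
integration by parts with $c=\sqrt t$ turns the second term into $\Delta\varphi$. -/
lemma hasDerivAt_integral_heatKernel_one (hφ : ContDiff ℝ ∞ φ) (hc : HasCompactSupport φ)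
    (τ : ℝ) (y : EuclideanSpace ℝ (Fin d)) {t : ℝ} (ht : 0 < t) :
    HasDerivAt (fun t => ∫ z, heatKernel 1 z * φ (τ + t, y + √t • z))
      (∫ z, heatKernel 1 z * adjointHeat φ (τ + t, y + √t • z)) t := by
  have hφd := hφ.differentiable (by simp)
  have hfc : Continuous (fderiv ℝ φ) := hφ.continuous_fderiv (by simp)
  obtain ⟨M₀, hM₀⟩ := hc.exists_bound_of_continuous hφ.continuous
  obtain ⟨M, hM⟩ := (hc.fderiv (𝕜 := ℝ)).exists_bound_of_continuous hfc
  have hM0 : 0 ≤ M := (norm_nonneg _).trans (hM 0)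
  have hk := continuous_heatKernel_one (d := d)
  have hderiv : ∀ s : ℝ, 0 < s → ∀ z : EuclideanSpace ℝ (Fin d),
      HasDerivAt (fun s => heatKernel 1 z * φ (τ + s, y + √s • z))
        (heatKernel 1 z * fderiv ℝ φ (τ + s, y + √s • z) (1, (1 / (2 * √s)) • z)) s := by
    intro s hs z
    refine HasDerivAt.const_mul _ ((hφd _).hasFDerivAt.comp_hasDerivAt s
      (f := fun s => (τ + s, y + √s • z)) ?_)
    refine HasDerivAt.prodMk ((hasDerivAt_id s).const_add τ) ?_
    exact ((Real.hasDerivAt_sqrt hs.ne').smul_const z).const_add y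
  have h := (hasDerivAt_integral_of_dominated_loc_of_deriv_le (𝕜 := ℝ) (μ := volume)
    (F := fun t z => heatKernel 1 z * φ (τ + t, y + √t • z))
    (F' := fun t z => heatKernel 1 z * fderiv ℝ φ (τ + t, y + √t • z) (1, (1 / (2 * √t)) • z))
    -- Staying above $t/2$ keeps the factor $1/(2\sqrt s)$ bounded, which gives an integrable
    -- dominating function.
    (s := Ioi (t / 2)) (x₀ := t)
    (bound := fun z => M * heatKernel 1 z + M * (1 / (2 * √(t / 2))) * (‖z‖ * heatKernel 1 z))
    (Ioi_mem_nhds (by linarith))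
    (Filter.Eventually.of_forall fun s => (hk.mul
      (hφ.continuous.comp (by fun_prop))).aestronglyMeasurable)
    (integrable_heatKernel_one_mul (hφ.continuous.comp (by fun_prop)) fun z => hM₀ _)
    (hk.mul ((hfc.comp (by fun_prop)).clm_apply (by fun_prop))).aestronglyMeasurable
    (Filter.Eventually.of_forall fun z s hs => ?_)
    (((integrable_heatKernel one_pos).const_mul _).add
      (integrable_norm_mul_heatKernel_one.const_mul _))
    (Filter.Eventually.of_forall fun z s hs =>
      hderiv s ((by positivity : (0 : ℝ) < t / 2).trans hs) z)).2
  · refine h.congr_deriv ?_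
    have hs : 0 < √t := Real.sqrt_pos.2 ht
    have e1 : ∀ z : EuclideanSpace ℝ (Fin d),
        heatKernel 1 z * fderiv ℝ φ (τ + t, y + √t • z) (1, (1 / (2 * √t)) • z)
        = heatKernel 1 z * fderiv ℝ φ (τ + t, y + √t • z) (1, 0)
          + 1 / (2 * √t) * (heatKernel 1 z * fderiv ℝ φ (τ + t, y + √t • z) (0, z)) := by
      intro z
      have : ((1, (1 / (2 * √t)) • z) : ℝ × EuclideanSpace ℝ (Fin d))
          = (1, 0) + (1 / (2 * √t)) • (0, z) := by simp
      rw [this, map_add, map_smul, smul_eq_mul]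
      ring
    have hI1 : Integrable fun z => heatKernel 1 z * fderiv ℝ φ (τ + t, y + √t • z) (1, 0) :=
      integrable_heatKernel_one_mul (M := M * ‖((1, 0) : ℝ × EuclideanSpace ℝ (Fin d))‖)
        ((hfc.comp (by fun_prop)).clm_apply continuous_const) fun z =>
          ((fderiv ℝ φ _).le_opNorm _).trans (mul_le_mul_of_nonneg_right (hM _) (norm_nonneg _))
    have hI2 : Integrable fun z => heatKernel 1 z * fderiv ℝ φ (τ + t, y + √t • z) (0, z) := by
      refine (integrable_norm_mul_heatKernel_one.const_mul M).mono'
        (hk.mul ((hfc.comp (by fun_prop)).clm_apply (by fun_prop))).aestronglyMeasurable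
        (Filter.Eventually.of_forall fun z => ?_)
      rw [norm_mul, Real.norm_of_nonneg (heatKernel_pos one_pos z).le]
      calc _ ≤ heatKernel 1 z * (M * ‖((0, z) : ℝ × EuclideanSpace ℝ (Fin d))‖) :=
            mul_le_mul_of_nonneg_left (((fderiv ℝ φ _).le_opNorm _).trans
              (mul_le_mul_of_nonneg_right (hM _) (norm_nonneg _))) (heatKernel_pos one_pos z).le
        _ = _ := by rw [Prod.norm_mk, norm_zero, max_eq_right (norm_nonneg z)]; ring
    have hI3 : Integrable fun z => heatKernel 1 z * adjointHeat φ (τ + t, y + √t • z) := by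
      obtain ⟨M', hM'⟩ := (hasCompactSupport_adjointHeat hc).exists_bound_of_continuous
        (continuous_adjointHeat hφ)
      exact integrable_heatKernel_one_mul ((continuous_adjointHeat hφ).comp (by fun_prop))
        fun z => hM' _
    have e2 : ∀ z : EuclideanSpace ℝ (Fin d), heatKernel 1 z * adjointHeat φ (τ + t, y + √t • z)
        = heatKernel 1 z * fderiv ℝ φ (τ + t, y + √t • z) (1, 0)
          + heatKernel 1 z * ∑ i : Fin d,
          fderiv ℝ (fun w => fderiv ℝ φ w (0, EuclideanSpace.single i 1)) (τ + t, y + √t • z)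
            (0, EuclideanSpace.single i 1) := fun z => by
      rw [adjointHeat, mul_add]
    have hI4 := hI3.sub hI1
    simp only [e2] at hI4
    simp only [e1, e2]
    have hI5 : Integrable fun z => heatKernel 1 z * ∑ i : Fin d,
          fderiv ℝ (fun w => fderiv ℝ φ w (0, EuclideanSpace.single i 1)) (τ + t, y + √t • z)
            (0, EuclideanSpace.single i 1) := hI4.congr
      (Filter.Eventually.of_forall fun z => by simp)
    rw [integral_add hI1 (hI2.const_mul _), integral_add hI1 hI5, integral_const_mul,
      integral_heatKernel_one_mul_fderiv hφ hc]
    field_simp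
  · have hs' : 0 < s := (by positivity : (0 : ℝ) < t / 2).trans hs
    rw [norm_mul, Real.norm_of_nonneg (heatKernel_pos one_pos z).le]
    have hkz := (heatKernel_pos one_pos z).le
    have hn : ‖((1, (1 / (2 * √s)) • z) : ℝ × EuclideanSpace ℝ (Fin d))‖
        ≤ 1 + 1 / (2 * √(t / 2)) * ‖z‖ := by
      rw [Prod.norm_mk, norm_one, norm_smul, Real.norm_of_nonneg (by positivity)]
      have : 1 / (2 * √s) ≤ 1 / (2 * √(t / 2)) := by
        have h2 : 0 < √(t / 2) := Real.sqrt_pos.2 (by positivity)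
        have h3 : √(t / 2) ≤ √s := Real.sqrt_le_sqrt (le_of_lt hs)
        gcongr
      refine max_le (by simp only [le_add_iff_nonneg_right]; positivity) ?_
      have h4 := mul_le_mul_of_nonneg_right this (norm_nonneg z)
      linarith
    calc _ ≤ heatKernel 1 z * (M * (1 + 1 / (2 * √(t / 2)) * ‖z‖)) := by
          refine mul_le_mul_of_nonneg_left (((fderiv ℝ φ _).le_opNorm _).trans ?_) hkz
          exact mul_le_mul (hM _) hn (norm_nonneg _) hM0
      _ = _ := by ring

lemma exists_time_bound_support {f : ℝ × EuclideanSpace ℝ (Fin d) → ℝ} (hc : HasCompactSupport f) :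
    ∃ ρ : ℝ, ∀ z, ρ ≤ ‖z‖ → f z = 0 := by
  obtain ⟨ρ, hρ⟩ := hc.isCompact.isBounded.subset_ball 0
  refine ⟨ρ, fun z hz => image_eq_zero_of_notMem_tsupport fun h => ?_⟩
  exact absurd (mem_ball_zero_iff.1 (hρ h)) (not_lt.2 hz)

lemma integrableOn_heatKernel_mul {f : ℝ × EuclideanSpace ℝ (Fin d) → ℝ} (hf : Continuous f)
    (hc : HasCompactSupport f) (τ : ℝ) (y : EuclideanSpace ℝ (Fin d)) :
    IntegrableOn (fun z => heatKernel (z.1 - τ) (z.2 - y) * f z)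
      (Ioi τ ×ˢ (univ : Set (EuclideanSpace ℝ (Fin d)))) := by
  obtain ⟨M, hM⟩ := hc.exists_bound_of_continuous hf
  obtain ⟨ρ, hρ⟩ := exists_time_bound_support hc
  have hM0 : 0 ≤ M := (norm_nonneg _).trans (hM 0)
  have hfm := hf.measurable
  have hm : Measurable fun z : ℝ × EuclideanSpace ℝ (Fin d) =>
      heatKernel (z.1 - τ) (z.2 - y) * f z := by fun_prop
  have hb : ∀ s ∈ Ioi τ, ∀ x, ‖heatKernel (s - τ) (x - y) * f (s, x)‖
      ≤ heatKernel (s - τ) (x - y) * (Ioo τ ρ).indicator (fun _ => M) s := by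
    intro s hs x
    rw [norm_mul, Real.norm_of_nonneg (heatKernel_pos (sub_pos.2 hs) _).le]
    refine mul_le_mul_of_nonneg_left ?_ (heatKernel_pos (sub_pos.2 hs) _).le
    by_cases h : s < ρ
    · rw [indicator_of_mem (show s ∈ Ioo τ ρ from ⟨hs, h⟩)]; exact hM _
    · rw [hρ (s, x) ((not_lt.1 h).trans ((le_abs_self s).trans (norm_fst_le (s, x)))), norm_zero]
      exact indicator_nonneg (fun _ _ => hM0) _
  have hki : ∀ s ∈ Ioi τ, Integrable fun x => heatKernel (s - τ) (x - y) :=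
    fun s hs => (integrable_heatKernel (sub_pos.2 hs)).comp_sub_right y
  rw [IntegrableOn, Measure.volume_eq_prod, ← Measure.prod_restrict, Measure.restrict_univ,
    integrable_prod_iff hm.aestronglyMeasurable]
  constructor
  · filter_upwards [ae_restrict_mem measurableSet_Ioi] with s hs
    exact ((hki s hs).mul_const _).mono' (hm.comp measurable_prodMk_left).aestronglyMeasurable
      (Filter.Eventually.of_forall (hb s hs))
  · refine Integrable.mono' (g := (Ioo τ ρ).indicator fun _ => M) ?_
      hm.norm.stronglyMeasurable.integral_prod_right'.aestronglyMeasurable ?_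
    · exact ((integrable_indicator_iff measurableSet_Ioo).2
        (integrableOn_const (by simp))).integrableOn
    · filter_upwards [ae_restrict_mem measurableSet_Ioi] with s hs
      rw [Real.norm_of_nonneg (integral_nonneg fun _ => norm_nonneg _)]
      refine (integral_mono_of_nonneg (Filter.Eventually.of_forall fun _ => norm_nonneg _)
        ((hki s hs).mul_const _) (Filter.Eventually.of_forall (hb s hs))).trans_eq ?_
      rw [integral_mul_const, integral_sub_right_eq_self (fun x => heatKernel (s - τ) x),
        integral_heatKernel (sub_pos.2 hs), one_mul]

/-- The heat kernel is a fundamental solution. -/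
theorem integral_heatKernel_mul_adjointHeat (hφ : ContDiff ℝ ∞ φ) (hc : HasCompactSupport φ)
    (τ : ℝ) (y : EuclideanSpace ℝ (Fin d)) :
    ∫ z in Ioi τ ×ˢ (univ : Set (EuclideanSpace ℝ (Fin d))),
      heatKernel (z.1 - τ) (z.2 - y) * adjointHeat φ z = -φ (τ, y) := by
  have hLc := hasCompactSupport_adjointHeat hc
  have hL := continuous_adjointHeat hφ
  have hint := integrableOn_heatKernel_mul hL hLc τ y
  obtain ⟨M, hM⟩ := hc.exists_bound_of_continuous hφ.continuous
  obtain ⟨ρ, hρ⟩ := exists_time_bound_support hc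
  have hk := continuous_heatKernel_one (d := d)
  rw [IntegrableOn, Measure.volume_eq_prod, ← Measure.prod_restrict, Measure.restrict_univ] at hint
  rw [Measure.volume_eq_prod, ← Measure.prod_restrict, Measure.restrict_univ,
    integral_prod _ hint]
  set f' : ℝ → ℝ := fun t => ∫ z, heatKernel 1 z * adjointHeat φ (τ + t, y + √t • z) with hf'
  have e1 : ∀ s ∈ Ioi τ, ∫ x, heatKernel (s - τ) (x - y) * adjointHeat φ (s, x) = f' (s - τ) := by
    intro s hs
    rw [integral_heatKernel_mul_eq (sub_pos.2 hs) (fun x => adjointHeat φ (s, x)) y]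
    simp only [f', add_sub_cancel]
  have hmp : MeasurePreserving (fun s : ℝ => s - τ) (volume.restrict (Ioi τ))
      (volume.restrict (Ioi 0)) := by
    have := (measurePreserving_sub_right volume τ).restrict_preimage
      (measurableSet_Ioi (a := (0 : ℝ)))
    convert this using 2
    ext s; simp
  have hemb : MeasurableEmbedding fun s : ℝ => s - τ :=
    (MeasurableEquiv.subRight τ).measurableEmbedding
  rw [setIntegral_congr_fun measurableSet_Ioi e1, hmp.integral_comp hemb f']
  have hint' : IntegrableOn f' (Ioi 0) := by
    have h := hint.integral_prod_left
    rw [IntegrableOn, ← hmp.integrable_comp_emb hemb]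
    refine h.congr ?_
    filter_upwards [ae_restrict_mem measurableSet_Ioi] with s hs using e1 s hs
  -- This is the antiderivative of `f'`, with value $\varphi(\tau,y)$ at $0$ and $0$ for large $t$.
  -- Continuity holds on all of $\mathbb R$ because `√` vanishes on negative numbers.
  have hcont : Continuous fun t : ℝ => ∫ z, heatKernel 1 z * φ (τ + t, y + √t • z) := by
    refine continuous_of_dominated (bound := fun z => heatKernel 1 z * M)
      (fun t => (hk.mul (hφ.continuous.comp (by fun_prop))).aestronglyMeasurable)
      (fun t => Filter.Eventually.of_forall fun z => ?_)
      ((integrable_heatKernel one_pos).mul_const M)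
      (Filter.Eventually.of_forall fun z => continuous_const.mul
        (hφ.continuous.comp (by fun_prop)))
    rw [norm_mul, Real.norm_of_nonneg (heatKernel_pos one_pos z).le]
    exact mul_le_mul_of_nonneg_left (hM _) (heatKernel_pos one_pos z).le
  have hlim : Filter.Tendsto (fun t : ℝ => ∫ z, heatKernel 1 z * φ (τ + t, y + √t • z))
      Filter.atTop (nhds 0) := by
    refine tendsto_const_nhds.congr' ?_
    filter_upwards [Filter.eventually_ge_atTop (ρ - τ)] with t ht
    have : ∀ z : EuclideanSpace ℝ (Fin d), φ (τ + t, y + √t • z) = 0 := fun z =>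
      hρ _ ((by linarith : ρ ≤ τ + t).trans ((le_abs_self _).trans
        (norm_fst_le (τ + t, y + √t • z))))
    simp [this]
  rw [integral_Ioi_of_hasDerivAt_of_tendsto hcont.continuousWithinAt
    (fun t ht => hasDerivAt_integral_heatKernel_one hφ hc τ y ht) hint' hlim]
  simp [integral_mul_const, integral_heatKernel one_pos]

end FundamentalSolution

/-! ### Mild solutions below a majorant are weak solutions -/

section WeakSolution

variable {d : ℕ}

/-- A positive lower bound on bounded sets, used to deduce local integrability from integrability
against the kernel. -/
lemma le_heatKernel {t t₁ R : ℝ} (ht : 1 ≤ t) (ht₁ : t ≤ t₁) {x : EuclideanSpace ℝ (Fin d)}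
    (hx : ‖x‖ ≤ R) :
    (4 * Real.pi * t₁) ^ (-(d : ℝ) / 2) * Real.exp (-R ^ 2 / 4) ≤ heatKernel t x := by
  have ht0 : 0 < t := by linarith
  have hx2 : ‖x‖ ^ 2 ≤ R ^ 2 := pow_le_pow_left₀ (norm_nonneg x) hx 2
  refine mul_le_mul ?_ (Real.exp_le_exp.2 ?_) (Real.exp_pos _).le (by positivity)
  · refine Real.rpow_le_rpow_of_nonpos (by positivity) (by gcongr) ?_
    rw [neg_div]; exact neg_nonpos.2 (by positivity)
  · rw [neg_div, neg_div, neg_le_neg_iff]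
    exact div_le_div₀ (sq_nonneg R) hx2 (by norm_num) (by linarith)

lemma integrableOn_slab_mul {f g : ℝ × EuclideanSpace ℝ (Fin d) → ℝ}
    (hf : ∀ ρ : ℝ, IntegrableOn f (Ioo 0 ρ ×ˢ Metric.ball (0 : EuclideanSpace ℝ (Fin d)) ρ))
    (hg : Continuous g) (hc : HasCompactSupport g) :
    IntegrableOn (fun z => g z * f z) (Ioi 0 ×ˢ (univ : Set (EuclideanSpace ℝ (Fin d)))) := by
  obtain ⟨M, hM⟩ := hc.exists_bound_of_continuous hg
  obtain ⟨ρ, hρ⟩ := exists_time_bound_support hc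
  have h1 : IntegrableOn (fun z => g z * f z)
      (Ioo 0 ρ ×ˢ Metric.ball (0 : EuclideanSpace ℝ (Fin d)) ρ) :=
    (hf ρ).bdd_mul hg.aestronglyMeasurable (Filter.Eventually.of_forall hM)
  refine h1.of_forall_sdiff_eq_zero (measurableSet_Ioi.prod MeasurableSet.univ) fun z hz => ?_
  have : g z = 0 := by
    refine hρ z (not_lt.1 fun h => hz.2 ⟨⟨hz.1.1, ?_⟩, ?_⟩)
    · exact (le_abs_self _).trans_lt ((norm_fst_le z).trans_lt h)
    · exact mem_ball_zero_iff.2 ((norm_snd_le z).trans_lt h)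
  rw [this, zero_mul]

namespace IsMajorant

variable {p : ℝ} {u₀ : EuclideanSpace ℝ (Fin d) → ℝ}
  {w u : ℝ → EuclideanSpace ℝ (Fin d) → ℝ}

lemma locallyIntegrable (hw : IsMajorant p u₀ w) : LocallyIntegrable u₀ := by
  refine locallyIntegrable_iff.2 fun K hK => ?_
  obtain ⟨R, hR⟩ := hK.isBounded.subset_closedBall 0
  set c := (4 * Real.pi * 1) ^ (-(d : ℝ) / 2) * Real.exp (-R ^ 2 / 4)
  have hc : 0 < c := by positivity
  refine Integrable.mono' (g := fun y => c⁻¹ * ‖heatKernel 1 (0 - y) * u₀ y‖)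
    ((hw.integrable_init 1 0 one_pos).norm.const_mul c⁻¹).integrableOn
    hw.measurable_init.aestronglyMeasurable ?_
  filter_upwards [ae_restrict_mem hK.measurableSet] with y hy
  have hy' : ‖0 - y‖ ≤ R := by simpa using mem_closedBall_zero_iff.1 (hR hy)
  rw [norm_mul, Real.norm_of_nonneg (heatKernel_pos one_pos _).le, ← mul_assoc]
  refine le_mul_of_one_le_left (norm_nonneg _) ?_
  rw [← div_eq_inv_mul, one_le_div hc]
  exact le_heatKernel le_rfl le_rfl hy'

lemma integrableOn_rpow (hw : IsMajorant p u₀ w) (τ R : ℝ) :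
    IntegrableOn (fun z : ℝ × EuclideanSpace ℝ (Fin d) => w z.1 z.2 ^ p)
      (Ioo 0 τ ×ˢ Metric.ball (0 : EuclideanSpace ℝ (Fin d)) R) := by
  rcases le_or_gt τ 0 with hτ | hτ
  · simp [Ioo_eq_empty (not_lt.2 hτ)]
  have hm := hw.measurable
  -- Observing from time $\tau+1$ keeps the elapsed time in $[1,\tau+1]$, away from the kernel's
  -- singularity.
  set c := (4 * Real.pi * (τ + 1)) ^ (-(d : ℝ) / 2) * Real.exp (-R ^ 2 / 4)
  have hc : 0 < c := by positivity
  refine Integrable.mono' (g := fun z : ℝ × EuclideanSpace ℝ (Fin d) =>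
      c⁻¹ * (heatKernel (τ + 1 - z.1) (0 - z.2) * w z.1 z.2 ^ p))
    (((hw.integrableOn (τ + 1) 0 (by linarith)).mono_set
      (prod_mono (Ioo_subset_Ioo_right (by linarith)) (subset_univ _))).const_mul c⁻¹)
    (hm.pow_const p).aestronglyMeasurable ?_
  filter_upwards [ae_restrict_mem (measurableSet_Ioo.prod measurableSet_ball)] with z hz
  have hz' : ‖0 - z.2‖ ≤ R := by simpa using (mem_ball_zero_iff.1 hz.2).le
  have hwp : 0 ≤ w z.1 z.2 ^ p := Real.rpow_nonneg (hw.nonneg _ _) _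
  rw [Real.norm_of_nonneg hwp, ← mul_assoc]
  refine le_mul_of_one_le_left hwp ?_
  rw [← div_eq_inv_mul, one_le_div hc]
  exact le_heatKernel (by linarith [hz.1.2]) (by linarith [hz.1.1]) hz'

lemma memLp (hw : IsMajorant p u₀ w) (hp : 1 < p) (τ R : ℝ) :
    MemLp (fun z : ℝ × EuclideanSpace ℝ (Fin d) => w z.1 z.2) (ENNReal.ofReal p)
      (volume.restrict (Ioo 0 τ ×ˢ Metric.ball (0 : EuclideanSpace ℝ (Fin d)) R)) := by
  have hp0 : 0 < p := by linarith
  rw [← integrable_norm_rpow_iff hw.measurable.aestronglyMeasurable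
    (by simpa using hp0) ENNReal.ofReal_ne_top, ENNReal.toReal_ofReal hp0.le]
  refine (hw.integrableOn_rpow τ R).congr (Filter.Eventually.of_forall fun z => ?_)
  simp only [Real.norm_of_nonneg (hw.nonneg z.1 z.2)]

lemma integrableOn_cylinder (hw : IsMajorant p u₀ w) (hp : 1 < p) (τ R : ℝ) :
    IntegrableOn (fun z : ℝ × EuclideanSpace ℝ (Fin d) => w z.1 z.2)
      (Ioo 0 τ ×ˢ Metric.ball (0 : EuclideanSpace ℝ (Fin d)) R) := by
  have : IsFiniteMeasure ((volume : Measure (ℝ × EuclideanSpace ℝ (Fin d))).restrict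
      (Ioo 0 τ ×ˢ Metric.ball (0 : EuclideanSpace ℝ (Fin d)) R)) := ⟨by
    rw [Measure.restrict_apply_univ, Measure.volume_eq_prod, Measure.prod_prod, Real.volume_Ioo]
    exact ENNReal.mul_lt_top ENNReal.ofReal_lt_top measure_ball_lt_top⟩
  exact (hw.memLp hp τ R).integrable (by simpa using hp.le)

/-- Fubini moves the kernel onto the test function, where it acts as a fundamental solution with
pole $(0,y)$. Absolute integrability holds because $e^{t\Delta}|u_0|\le w$ and $w$ is integrable on
bounded cylinders. -/
lemma integral_heatFlow_mul_adjointHeat (hw : IsMajorant p u₀ w) (hp : 1 < p)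
    {φ : ℝ × EuclideanSpace ℝ (Fin d) → ℝ} (hφ : ContDiff ℝ ∞ φ) (hc : HasCompactSupport φ) :
    IntegrableOn (fun z => (∫ y, heatKernel z.1 (z.2 - y) * u₀ y) * adjointHeat φ z)
      (Ioi 0 ×ˢ univ) ∧
    ∫ z in Ioi 0 ×ˢ univ, (∫ y, heatKernel z.1 (z.2 - y) * u₀ y) * adjointHeat φ z
      = -∫ y, u₀ y * φ (0, y) := by
  set L := adjointHeat φ
  have hL : Continuous L := continuous_adjointHeat hφ
  have hLm := hL.measurable
  have hLc : HasCompactSupport L := hasCompactSupport_adjointHeat hc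
  have hu₀ := hw.measurable_init
  let S : Set (ℝ × EuclideanSpace ℝ (Fin d)) := Ioi 0 ×ˢ univ
  have hS : MeasurableSet S := measurableSet_Ioi.prod MeasurableSet.univ
  have hm : Measurable (Function.uncurry fun (z : ℝ × EuclideanSpace ℝ (Fin d))
      (y : EuclideanSpace ℝ (Fin d)) => heatKernel z.1 (z.2 - y) * u₀ y * L z) := by
    unfold Function.uncurry
    fun_prop
  have hint : Integrable (Function.uncurry fun (z : ℝ × EuclideanSpace ℝ (Fin d))
      (y : EuclideanSpace ℝ (Fin d)) => heatKernel z.1 (z.2 - y) * u₀ y * L z)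
      ((volume.restrict S).prod volume) := by
    rw [integrable_prod_iff hm.aestronglyMeasurable]
    constructor
    · filter_upwards [ae_restrict_mem hS] with z hz
      exact (hw.integrable_init z.1 z.2 hz.1).mul_const (L z)
    · refine Integrable.mono (integrableOn_slab_mul (fun ρ => hw.integrableOn_cylinder hp ρ ρ) hL hLc)
        hm.norm.stronglyMeasurable.integral_prod_right'.aestronglyMeasurable ?_
      filter_upwards [ae_restrict_mem hS] with z hz
      rw [Real.norm_of_nonneg (integral_nonneg fun _ => norm_nonneg _), norm_mul,
        Real.norm_of_nonneg (hw.nonneg _ _)]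
      simp only [Function.uncurry, norm_mul, integral_mul_const]
      rw [mul_comm]
      refine mul_le_mul_of_nonneg_left (le_trans ?_ (hw.le z.1 z.2 hz.1)) (norm_nonneg _)
      rw [integral_congr_ae (g := fun y => heatKernel z.1 (z.2 - y) * |u₀ y|)
        (Filter.Eventually.of_forall fun y => by
          simp only [Real.norm_eq_abs, abs_of_pos (heatKernel_pos (show 0 < z.1 from hz.1) (z.2 - y))])]
      refine le_add_of_nonneg_right (integral_nonneg_of_ae (ae_restrict_slab fun ζ _ hζ => ?_))
      exact mul_nonneg (heatKernel_pos (sub_pos.2 hζ) _).le (Real.rpow_nonneg (hw.nonneg _ _) _)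
  have h1 := hint.integral_prod_left
  have h2 := integral_integral_swap hint
  simp only [Function.uncurry, integral_mul_const] at h1 h2
  refine ⟨h1, h2.trans ?_⟩
  rw [← integral_neg]
  refine integral_congr_ae (Filter.Eventually.of_forall fun y => ?_)
  have h3 := integral_heatKernel_mul_adjointHeat hφ hc 0 y
  simp only [sub_zero] at h3
  simp only [mul_right_comm _ (u₀ y), integral_mul_const]
  rw [h3]
  ring

/-- The same exchange with the pole at each earlier point $\zeta$; here $w$ dominates the Duhamel
integral of $|u|^p$. -/
lemma integral_duhamel_mul_adjointHeat (hw : IsMajorant p u₀ w) (hp : 1 < p)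
    (hu : Measurable fun z : ℝ × EuclideanSpace ℝ (Fin d) => u z.1 z.2)
    (huw : ∀ t x, 0 < t → |u t x| ≤ w t x)
    {φ : ℝ × EuclideanSpace ℝ (Fin d) → ℝ} (hφ : ContDiff ℝ ∞ φ) (hc : HasCompactSupport φ) :
    IntegrableOn (fun z : ℝ × EuclideanSpace ℝ (Fin d) => (∫ ζ in Ioo 0 z.1 ×ˢ univ,
      heatKernel (z.1 - ζ.1) (z.2 - ζ.2) * powerNonlinearity p (u ζ.1 ζ.2)) * adjointHeat φ z)
      (Ioi 0 ×ˢ univ) ∧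
    ∫ z in Ioi 0 ×ˢ (univ : Set (EuclideanSpace ℝ (Fin d))), (∫ ζ in Ioo 0 z.1 ×ˢ univ,
      heatKernel (z.1 - ζ.1) (z.2 - ζ.2) * powerNonlinearity p (u ζ.1 ζ.2)) * adjointHeat φ z
      = -∫ ζ in Ioi 0 ×ˢ univ, powerNonlinearity p (u ζ.1 ζ.2) * φ ζ := by
  set L := adjointHeat φ
  have hL : Continuous L := continuous_adjointHeat hφ
  have hLm := hL.measurable
  have hLc : HasCompactSupport L := hasCompactSupport_adjointHeat hc
  have hFm : Measurable fun ζ : ℝ × EuclideanSpace ℝ (Fin d) => powerNonlinearity p (u ζ.1 ζ.2) :=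
    (continuous_powerNonlinearity hp).measurable.comp hu
  let S : Set (ℝ × EuclideanSpace ℝ (Fin d)) := Ioi 0 ×ˢ univ
  have hS : MeasurableSet S := measurableSet_Ioi.prod MeasurableSet.univ
  let G : ℝ × EuclideanSpace ℝ (Fin d) → ℝ × EuclideanSpace ℝ (Fin d) → ℝ := fun z ζ =>
    (Ioo 0 z.1 ×ˢ univ).indicator
      (fun ζ => heatKernel (z.1 - ζ.1) (z.2 - ζ.2) * powerNonlinearity p (u ζ.1 ζ.2)) ζ * L z
  have hm : Measurable (Function.uncurry G) := by
    refine Measurable.mul ?_ (by fun_prop)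
    have h : Measurable fun q : (ℝ × EuclideanSpace ℝ (Fin d)) × (ℝ × EuclideanSpace ℝ (Fin d)) =>
        {q : (ℝ × EuclideanSpace ℝ (Fin d)) × (ℝ × EuclideanSpace ℝ (Fin d)) |
          0 < q.2.1 ∧ q.2.1 < q.1.1}.indicator (fun q => heatKernel (q.1.1 - q.2.1) (q.1.2 - q.2.2)
            * powerNonlinearity p (u q.2.1 q.2.2)) q := by
      refine Measurable.indicator ?_ ?_
      · exact Measurable.mul (by fun_prop) (hFm.comp measurable_snd)
      · exact (measurableSet_lt measurable_const (measurable_fst.comp measurable_snd)).inter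
          (measurableSet_lt (measurable_fst.comp measurable_snd)
            (measurable_fst.comp measurable_fst))
    convert h using 2 with q
    simp [indicator]
  have hSt : ∀ t : ℝ, MeasurableSet (Ioo 0 t ×ˢ (univ : Set (EuclideanSpace ℝ (Fin d)))) :=
    fun t => measurableSet_Ioo.prod MeasurableSet.univ
  have hsub : ∀ t, Ioo 0 t ×ˢ (univ : Set (EuclideanSpace ℝ (Fin d))) ⊆ S :=
    fun t => prod_mono Ioo_subset_Ioi_self subset_rfl
  have hslice : ∀ z ∈ S, Integrable ((Ioo 0 z.1 ×ˢ univ).indicator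
      (fun ζ : ℝ × EuclideanSpace ℝ (Fin d) =>
        heatKernel (z.1 - ζ.1) (z.2 - ζ.2) * powerNonlinearity p (u ζ.1 ζ.2)))
      (volume.restrict S) := fun z hz => by
    have h := (integrable_indicator_iff (hSt z.1)).2 (hw.integrableOn_duhamel hp hu huw hz.1 z.2)
    exact h.mono_measure Measure.restrict_le_self
  have hint : Integrable (Function.uncurry G) ((volume.restrict S).prod (volume.restrict S)) := by
    rw [integrable_prod_iff hm.aestronglyMeasurable]
    constructor
    · filter_upwards [ae_restrict_mem hS] with z hz
      exact (hslice z hz).mul_const (L z)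
    · refine Integrable.mono (integrableOn_slab_mul (fun ρ => hw.integrableOn_cylinder hp ρ ρ) hL hLc)
        hm.norm.stronglyMeasurable.integral_prod_right'.aestronglyMeasurable ?_
      filter_upwards [ae_restrict_mem hS] with z hz
      rw [Real.norm_of_nonneg (integral_nonneg fun _ => norm_nonneg _), norm_mul,
        Real.norm_of_nonneg (hw.nonneg _ _)]
      simp only [Function.uncurry, G, norm_mul, integral_mul_const, norm_indicator_eq_indicator_norm]
      rw [mul_comm, setIntegral_indicator (hSt _), inter_eq_right.2 (hsub _)]
      refine mul_le_mul_of_nonneg_left (le_trans ?_ (hw.le z.1 z.2 hz.1)) (norm_nonneg _)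
      refine (integral_mono_of_nonneg (Filter.Eventually.of_forall fun _ => by positivity)
        (hw.integrableOn z.1 z.2 hz.1) (ae_restrict_slab fun ζ hζ hζz => ?_)).trans
        (le_add_of_nonneg_left (integral_nonneg fun y =>
          mul_nonneg (heatKernel_pos hz.1 _).le (abs_nonneg _)))
      have hk := (heatKernel_pos (sub_pos.2 hζz) (z.2 - ζ.2)).le
      simp only [Real.norm_of_nonneg hk]
      exact mul_le_mul_of_nonneg_left (abs_powerNonlinearity_le hp (huw _ _ hζ)) hk
  have h1 := hint.integral_prod_left
  have h2 := integral_integral_swap hint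
  simp only [Function.uncurry, G, integral_mul_const] at h1 h2
  have e1 : ∀ z : ℝ × EuclideanSpace ℝ (Fin d), ∫ ζ in S, (Ioo 0 z.1 ×ˢ univ).indicator
      (fun ζ => heatKernel (z.1 - ζ.1) (z.2 - ζ.2) * powerNonlinearity p (u ζ.1 ζ.2)) ζ
      = ∫ ζ in Ioo 0 z.1 ×ˢ univ,
        heatKernel (z.1 - ζ.1) (z.2 - ζ.2) * powerNonlinearity p (u ζ.1 ζ.2) := fun z => by
    rw [setIntegral_indicator (hSt _), inter_eq_right.2 (hsub _)]
  simp only [e1] at h1 h2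
  refine ⟨h1, h2.trans ?_⟩
  rw [← integral_neg]
  refine setIntegral_congr_fun hS fun ζ hζ => ?_
  have h3 := integral_heatKernel_mul_adjointHeat hφ hc ζ.1 ζ.2
  -- The constraint $\zeta_1<z_1$ is read as a condition on $z$ instead of on $\zeta$.
  have e2 : ∀ z ∈ S, (Ioo 0 z.1 ×ˢ univ).indicator
      (fun ζ => heatKernel (z.1 - ζ.1) (z.2 - ζ.2) * powerNonlinearity p (u ζ.1 ζ.2)) ζ * L z
      = powerNonlinearity p (u ζ.1 ζ.2) * (Ioi ζ.1 ×ˢ univ).indicator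
        (fun z => heatKernel (z.1 - ζ.1) (z.2 - ζ.2) * L z) z := by
    intro z _
    by_cases h : ζ.1 < z.1
    · rw [indicator_of_mem (show ζ ∈ Ioo 0 z.1 ×ˢ univ from ⟨⟨hζ.1, h⟩, trivial⟩),
        indicator_of_mem (show z ∈ Ioi ζ.1 ×ˢ univ from ⟨h, trivial⟩)]
      ring
    · rw [indicator_of_notMem (fun h' => h h'.1.2), indicator_of_notMem (fun h' => h h'.1)]
      ring
  have hsub' : Ioi ζ.1 ×ˢ (univ : Set (EuclideanSpace ℝ (Fin d))) ⊆ S :=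
    prod_mono (Ioi_subset_Ioi (le_of_lt hζ.1)) subset_rfl
  rw [setIntegral_congr_fun hS e2, integral_const_mul,
    setIntegral_indicator (measurableSet_Ioi.prod MeasurableSet.univ), inter_eq_right.2 hsub', h3]
  ring

theorem isWeakSolution (hw : IsMajorant p u₀ w) (hp : 1 < p)
    (hu : Measurable fun z : ℝ × EuclideanSpace ℝ (Fin d) => u z.1 z.2)
    (huw : ∀ t x, 0 < t → |u t x| ≤ w t x)
    (hfix : ∀ t x, 0 < t → u t x = duhamelMap p u₀ u t x) : IsWeakSolution p u₀ ⊤ u where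
  init_locallyIntegrable := hw.locallyIntegrable
  memLp τ R _ := by
    refine (hw.memLp hp τ R).mono (g := fun z : ℝ × EuclideanSpace ℝ (Fin d) => w z.1 z.2)
      hu.aestronglyMeasurable ?_
    filter_upwards [ae_restrict_mem (measurableSet_Ioo.prod measurableSet_ball)] with z hz
    rw [Real.norm_of_nonneg (hw.nonneg _ _)]
    exact huw _ _ hz.1.1
  weak_eq φ hφ hc _ := by
    simp only [deriv_add_laplacian_eq_adjointHeat hφ]
    have hS : MeasurableSet (Ioi (0 : ℝ) ×ˢ (univ : Set (EuclideanSpace ℝ (Fin d)))) :=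
      measurableSet_Ioi.prod MeasurableSet.univ
    obtain ⟨hA, hA'⟩ := hw.integral_heatFlow_mul_adjointHeat hp hφ hc
    obtain ⟨hB, hB'⟩ := hw.integral_duhamel_mul_adjointHeat hp hu huw hφ hc
    have hF : IntegrableOn (fun z => powerNonlinearity p (u z.1 z.2) * φ z)
        (Ioi 0 ×ˢ (univ : Set (EuclideanSpace ℝ (Fin d)))) := by
      refine Integrable.mono (integrableOn_slab_mul (fun ρ => hw.integrableOn_rpow ρ ρ) hφ.continuous hc)
        (((continuous_powerNonlinearity hp).measurable.comp hu).mul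
          hφ.continuous.measurable).aestronglyMeasurable ?_
      filter_upwards [ae_restrict_mem hS] with z hz
      rw [norm_mul, norm_mul, mul_comm, Real.norm_of_nonneg (Real.rpow_nonneg (hw.nonneg _ _) _)]
      exact mul_le_mul_of_nonneg_left (abs_powerNonlinearity_le hp (huw _ _ hz.1)) (norm_nonneg _)
    rw [setIntegral_congr_fun (g := fun z : ℝ × EuclideanSpace ℝ (Fin d) =>
      (∫ y, heatKernel z.1 (z.2 - y) * u₀ y) * adjointHeat φ z + (∫ ζ in Ioo 0 z.1 ×ˢ univ,
        heatKernel (z.1 - ζ.1) (z.2 - ζ.2) * powerNonlinearity p (u ζ.1 ζ.2)) * adjointHeat φ z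
        + powerNonlinearity p (u z.1 z.2) * φ z) hS fun z hz => by
          simp only [← add_mul]; rw [hfix z.1 z.2 hz.1]; rfl]
    rw [integral_add (by exact hA.add hB) hF, integral_add hA hB, hA', hB']
    ring

end IsMajorant

end WeakSolution

/-! ### Global existence for small Morrey norm -/

section Existence

variable {d : ℕ}

lemma morreyNorm_congr_ae {s q : ℝ} {f g : EuclideanSpace ℝ (Fin d) → ℝ} (h : f =ᵐ[volume] g) :
    morreyNorm s q f = morreyNorm s q g := by
  have : ∀ (x : EuclideanSpace ℝ (Fin d)) (R : ℝ),
      ∫⁻ y in Metric.ball x R, ‖f y‖ₑ ^ q = ∫⁻ y in Metric.ball x R, ‖g y‖ₑ ^ q := fun x R =>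
    lintegral_congr_ae (ae_restrict_of_ae (by filter_upwards [h] with y hy; rw [hy]))
  simp only [morreyNorm, this]

lemma IsWeakSolution.congr_init {p : ℝ} {T : ℝ≥0∞} {f g : EuclideanSpace ℝ (Fin d) → ℝ}
    {u : ℝ → EuclideanSpace ℝ (Fin d) → ℝ} (h : IsWeakSolution p f T u) (hfg : f =ᵐ[volume] g) :
    IsWeakSolution p g T u where
  init_locallyIntegrable := h.init_locallyIntegrable.congr hfg
  memLp := h.memLp
  weak_eq φ hφ hc ht := by
    have e : (fun y => f y * φ (0, y)) =ᵐ[volume] fun y => g y * φ (0, y) := by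
      filter_upwards [hfg] with y hy; rw [hy]
    rw [← integral_congr_ae e]
    exact h.weak_eq φ hφ hc ht

lemma IsMildSolution.congr_init {p : ℝ} {T : ℝ≥0∞} {f g : EuclideanSpace ℝ (Fin d) → ℝ}
    {u : ℝ → EuclideanSpace ℝ (Fin d) → ℝ} (h : IsMildSolution p f T u) (hfg : f =ᵐ[volume] g) :
    IsMildSolution p g T u := fun t x ht htT => by
  obtain ⟨h1, h2, h3⟩ := h t x ht htT
  have e : (fun y => heatKernel t (x - y) * f y) =ᵐ[volume]
      fun y => heatKernel t (x - y) * g y := by filter_upwards [hfg] with y hy; rw [hy]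
  exact ⟨h1.congr e, h2, by rw [h3, integral_congr_ae e]⟩

/-- Balls carry mass at most $c^qR^\beta$ with $\beta=d(1-q/s)$, and
$(\beta-d)/(2q)=-d/(2s)=-1/(p-1)$: the decay rate does not depend on $q$. -/
lemma heatMean_le_of_morreyNorm_lt {p q C c : ℝ} (hd : 1 ≤ d) (hp : 1 < p) (hq : 0 < q)
    (hC : 0 < C) (hc : 0 < c)
    (hflow : ∀ (f : EuclideanSpace ℝ (Fin d) → ℝ≥0∞), Measurable f →
      ∀ (β : ℝ) (N : ℝ≥0∞), β ≤ d →
        (∀ x, ∀ R : ℝ, 0 < R → ∫⁻ y in Metric.ball x R, f y ≤ ENNReal.ofReal (R ^ β) * N) →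
        ∀ (t : ℝ) (x : EuclideanSpace ℝ (Fin d)), 0 < t →
          heatFlow f t x ≤ ENNReal.ofReal (C * t ^ ((β - d) / 2)) * N)
    {u₀ : EuclideanSpace ℝ (Fin d) → ℝ} (hu₀ : Measurable u₀)
    (hM : morreyNorm ((d : ℝ) * (p - 1) / 2) q u₀ < ENNReal.ofReal c) {t : ℝ} (ht : 0 < t)
    (x : EuclideanSpace ℝ (Fin d)) :
    heatMean q u₀ t x ≤ ENNReal.ofReal (C ^ (1 / q) * c * t ^ (-1 / (p - 1))) := by
  have hd0 : (0 : ℝ) < d := by exact_mod_cast hd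
  have hp1 : 0 < p - 1 := by linarith
  set s := (d : ℝ) * (p - 1) / 2 with hs
  have hs0 : 0 < s := by positivity
  have hN : ∀ (x : EuclideanSpace ℝ (Fin d)) (R : ℝ), 0 < R →
      ENNReal.ofReal (R ^ ((d : ℝ) * (q / s - 1))) * ∫⁻ y in Metric.ball x R, ‖u₀ y‖ₑ ^ q
        ≤ ENNReal.ofReal (c ^ q) := by
    intro x R hR
    have h1 := hM.le
    rw [morreyNorm, one_div, ENNReal.rpow_inv_le_iff hq, ENNReal.ofReal_rpow_of_pos hc] at h1
    exact (le_iSup₂_of_le x R (le_iSup (fun _ : 0 < R => _) hR)).trans h1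
  have hball : ∀ (x : EuclideanSpace ℝ (Fin d)) (R : ℝ), 0 < R →
      ∫⁻ y in Metric.ball x R, ‖u₀ y‖ₑ ^ q
        ≤ ENNReal.ofReal (R ^ ((d : ℝ) * (1 - q / s))) * ENNReal.ofReal (c ^ q) := by
    intro x R hR
    refine le_trans (le_of_eq ?_) (mul_le_mul_right (hN x R hR) _)
    rw [← mul_assoc, ← ENNReal.ofReal_mul (by positivity), ← Real.rpow_add hR]
    rw [show (d : ℝ) * (1 - q / s) + d * (q / s - 1) = 0 by ring, Real.rpow_zero,
      ENNReal.ofReal_one, one_mul]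
  have h := hflow (fun y => ‖u₀ y‖ₑ ^ q) (by fun_prop) _ _
    (mul_le_of_le_one_right hd0.le (by linarith [div_pos hq hs0])) hball t x ht
  rw [← ENNReal.ofReal_mul (by positivity)] at h
  refine (ENNReal.rpow_le_rpow h (by positivity)).trans_eq ?_
  rw [ENNReal.ofReal_rpow_of_nonneg (by positivity) (by positivity),
    Real.mul_rpow (by positivity) (by positivity), Real.mul_rpow hC.le (by positivity),
    ← Real.rpow_mul ht.le, ← Real.rpow_mul hc.le, mul_one_div_cancel hq.ne', Real.rpow_one,
    show ((d : ℝ) * (1 - q / s) - d) / 2 * (1 / q) = -1 / (p - 1) by rw [hs]; field_simp; ring]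
  congr 1
  ring

theorem exists_global_solution {p q : ℝ} (hd : 1 ≤ d) (hp : 1 < p) (hq : 1 < q) :
    ∃ c : ℝ, 0 < c ∧ ∀ u₀ : EuclideanSpace ℝ (Fin d) → ℝ, AEStronglyMeasurable u₀ volume →
      morreyNorm ((d : ℝ) * (p - 1) / 2) q u₀ < ENNReal.ofReal c →
      ∃ u : ℝ → EuclideanSpace ℝ (Fin d) → ℝ,
        IsWeakSolution p u₀ ⊤ u ∧ IsMildSolution p u₀ ⊤ u ∧
        (∀ ε τ : ℝ, 0 < ε → ε < τ → ∃ B : ℝ, ∀ t ∈ Set.Icc ε τ, ∀ x, |u t x| ≤ B) ∧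
        ((∀ᵐ x, 0 ≤ u₀ x) → ∀ t : ℝ, 0 < t → ∀ x, 0 ≤ u t x) := by
  obtain ⟨C, hC, hflow⟩ := exists_heatFlow_le_of_ball_le d
  have hp1 : 0 < p - 1 := by linarith
  -- $r\le p$ permits the splitting of $W^p$, while $r\le q$ lets Jensen bound the $r$-mean by the
  -- $q$-mean, which the Morrey norm controls.
  set r := min p q
  have hr : 1 < r := lt_min hp hq
  have hr1 : 0 < r - 1 := by linarith
  set A := 2 ^ p * ((p - 1) / (r - 1))
  have hA : 0 < A := by positivity
  -- The value for which the smallness condition of `isMajorant_heatMean` is an equality.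
  set κ := A⁻¹ ^ (1 / (p - 1))
  have hκ : 0 < κ := by positivity
  have hκs : 2 ^ p * (κ ^ (p - 1) * ((p - 1) / (r - 1))) ≤ 1 := by
    rw [← Real.rpow_mul (by positivity), one_div_mul_cancel hp1.ne', Real.rpow_one,
      mul_left_comm]
    exact (inv_mul_cancel₀ hA.ne').le
  have hCq : 0 < C ^ (1 / q) := by positivity
  refine ⟨κ / C ^ (1 / q), by positivity, fun f hf hM => ?_⟩
  -- The construction needs a Borel representative; the norm and both notions of solution see the
  -- data only almost everywhere.
  have hfu := hf.ae_eq_mk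
  set u₀ := hf.mk f
  have hu₀ : Measurable u₀ := hf.stronglyMeasurable_mk.measurable
  rw [morreyNorm_congr_ae hfu] at hM
  have hW : ∀ t x, 0 < t → heatMean r u₀ t x ≤ ENNReal.ofReal (κ * t ^ (-1 / (p - 1))) := by
    intro t x ht
    refine (heatFlow_rpow_le hu₀ ht (by linarith) (min_le_right p q) x).trans ?_
    have h := heatMean_le_of_morreyNorm_lt hd hp (by linarith) hC (by positivity) hflow hu₀ hM ht x
    rwa [mul_div_cancel₀ κ hCq.ne'] at h
  have hw := isMajorant_heatMean hr (min_le_left p q) hκ hκs hu₀ hW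
  obtain ⟨u, hum, huw, hfix, hnn⟩ := hw.exists_fixedPoint hp
  refine ⟨u, (hw.isWeakSolution hp hum huw hfix).congr_init hfu.symm,
    IsMildSolution.congr_init (f := u₀) (fun t x ht _ => ⟨hw.integrable_init t x ht,
      hw.integrableOn_duhamel hp hum huw ht x, hfix t x ht⟩) hfu.symm,
    fun ε τ hε _ => ⟨2 * (κ * ε ^ (-1 / (p - 1))), fun t ht x => ?_⟩, fun hf0 t ht x =>
      hnn (by filter_upwards [hf0, hfu] with y hy hy'; rwa [← hy']) t x ht⟩
  have ht0 : 0 < t := hε.trans_le ht.1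
  refine (huw t x ht0).trans (mul_le_mul_of_nonneg_left ?_ zero_le_two)
  refine (ENNReal.toReal_le_of_le_ofReal (by positivity) (hW t x ht0)).trans ?_
  refine mul_le_mul_of_nonneg_left (Real.rpow_le_rpow_of_nonpos hε ht.1 ?_) hκ.le
  rw [neg_div]
  exact neg_nonpos.2 (by positivity)

end Existence

theorem mainTheorem3 (d : ℕ) (hd : 1 ≤ d) :
    ∃ C : ℝ, 0 < C ∧ ∀ p : ℝ, 1 + 2 / (d : ℝ) < p →
      (∀ q : ℝ, 1 < q → q ≤ (d : ℝ) * (p - 1) / 2 →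
        ∃ c : ℝ, 0 < c ∧ ∀ u₀ : EuclideanSpace ℝ (Fin d) → ℝ, AEStronglyMeasurable u₀ volume →
          morreyNorm ((d : ℝ) * (p - 1) / 2) q u₀ < ENNReal.ofReal c →
          ∃ u : ℝ → EuclideanSpace ℝ (Fin d) → ℝ,
            IsWeakSolution p u₀ ⊤ u ∧ IsMildSolution p u₀ ⊤ u ∧
            (∀ ε τ : ℝ, 0 < ε → ε < τ → ∃ B : ℝ, ∀ t ∈ Set.Icc ε τ, ∀ x, |u t x| ≤ B) ∧
            ((∀ᵐ x, 0 ≤ u₀ x) → ∀ t : ℝ, 0 < t → ∀ x, 0 ≤ u t x)) ∧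
      (∀ u₀ : EuclideanSpace ℝ (Fin d) → ℝ, (∀ᵐ x, 0 ≤ u₀ x) →
        ENNReal.ofReal C < morreyNorm ((d : ℝ) * (p - 1) / 2) 1 u₀ →
        ∃ T₀ : ℝ, 0 < T₀ ∧ ∀ (T : ℝ≥0∞) (u : ℝ → EuclideanSpace ℝ (Fin d) → ℝ),
          IsWeakSolution p u₀ T u →
          (∀ᵐ z : ℝ × EuclideanSpace ℝ (Fin d),
            0 < z.1 → ENNReal.ofReal z.1 < T → 0 ≤ u z.1 z.2) →
          T ≤ ENNReal.ofReal T₀) := by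
  obtain ⟨C, hC, hblow⟩ := exists_blowup_constant hd
  refine ⟨C, hC, fun p hp => ⟨fun q hq _ => ?_, hblow p hp⟩⟩
  have hp1 : 1 < p := by
    have : 0 ≤ 2 / (d : ℝ) := by positivity
    linarith
  exact exists_global_solution hd hp1 hq
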